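/- Let $\mathbf X_t$, $t\in\mathbb Z$, be a $d$-dimensional complex, zero-mean, weakly stationary time series on a probability space that has constant rank $r$, $1\le r\le d$: it has an integrable, non-negative definite spectral density $\mathbf f$ on $[-\pi,\pi]$, so that $\mathbb E(\mathbf X_{t+h}\mathbf X_t^*)=\int_{-\pi}^{\pi}e^{ih\omega}\mathbf f(\omega)\,d\omega$ for all $t,h\in\mathbb Z$, and $\operatorname{rank}\mathbf f(\omega)=r$ for a.e. $\omega$. Let $$\mathbf f(\omega)=\tilde{\mathbf U}_r(\omega)\,\mathrm{diag}[\lambda_1(\omega),\dots,\lambda_r(\omega)]\,\tilde{\mathbf U}_r^*(\omega)\quad\text{for a.e. }\omega\in[-\pi,\pi]$$ be a measurable spectral decomposition, where $\lambda_1(\omega)\ge\dots\ge\lambda_r(\omega)>0=\lambda_{r+1}(\omega)=\dots=\lambda_d(\omega)$ are the eigenvalues of $\mathbf f(\omega)$ and $\tilde{\mathbf U}_r(\omega)\in\mathbb C^{d\times r}$ has orthonormal columns; $\tilde{\mathbf U}_k$ denotes the matrix of its first $k$ columns. Write $\|\mathbf V\|^2=\mathbb E(\mathbf V^*\mathbf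 V)$ for a square integrable random vector $\mathbf V$. Then $\mathbf X$ has a Cramér representation $\mathbf X_t=\int_{-\pi}^{\pi}e^{it\omega}\,d\mathbf Z_\omega$, $t\in\mathbb Z$, with a unique random spectral measure $\mathbf Z$, that is, an $L^2$-valued vector measure with $\mathbb E(\mathbf Z(A)\mathbf Z(B)^*)=\int_{A\cap B}\mathbf f(\omega)\,d\omega$ for all Borel sets $A,B$ (where $\mathbf f=0$ outside $[-\pi,\pi]$). Let $1\le k\le r$. (a) The process $$\mathbf X_t^{(k)}=\int_{-\pi}^{\pi}e^{it\omega}\,\tilde{\mathbf U}_k(\omega)\tilde{\mathbf U}_k^*(\omega)\,d\mathbf Z_\omega,\qquad t\in\mathbb Z,$$ is well defined and of constant rank $k$, its transfer function $\tilde{\mathbf U}_k\tilde{\mathbf U}_k^*$ has rank $k$ a.e., and it minimizes the mean square error among the linear transforms of $\mathbf X$ of rank at most $k$: for every process $\mathbf Y_t=\int_{-\pi}^{\pi}e^{it\omega}\mathbf T(\omega)\,d\mathbf Z_\omega$, $t\in\mathbb Z$, with a measurable transfer function $\mathbf T$ satisfying $\operatorname{tr}\int_{-\pi}^{\pi}\mathbf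 T\mathbf f\mathbf T^*\,d\omega<\infty$, such that the spectral density of $\mathbf Y$ has rank at most $k$ a.e. (in particular, if $\mathbf Y$ has constant rank $k$) or $\operatorname{rank}\mathbf T(\omega)\le k$ a.e., one has $\|\mathbf X_t-\mathbf X^{(k)}_t\|^2\le\|\mathbf X_t-\mathbf Y_t\|^2$ for all $t\in\mathbb Z$. (b) The functions $\sum_{j=1}^r\lambda_j$ and $\sum_{j=k+1}^r\lambda_j$ are integrable on $[-\pi,\pi]$, and for all $t\in\mathbb Z$ we have $\|\mathbf X_t\|>0$, $$\|\mathbf X_t-\mathbf X_t^{(k)}\|^2=\int_{-\pi}^{\pi}\sum_{j=k+1}^r\lambda_j(\omega)\,d\omega\qquad\text{and}\qquad\frac{\|\mathbf X_t-\mathbf X_t^{(k)}\|^2}{\|\mathbf X_t\|^2}=\frac{\int_{-\pi}^{\pi}\sum_{j=k+1}^r\lambda_j(\omega)\,d\omega}{\int_{-\pi}^{\pi}\sum_{j=1}^r\lambda_j(\omega)\,d\omega}.$$ (c) If $\Delta>\epsilon$ are real numbers with $\lambda_k(\omega)\ge\Delta>\epsilon\ge\lambda_{k+1}(\omega)$ for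 a.e. $\omega\in[-\pi,\pi]$ (if $k=d$, $\lambda_{d+1}$ may be taken to be any real function), then for all $t\in\mathbb Z$ $$\|\mathbf X_t-\mathbf X_t^{(k)}\|\le\bigl(2\pi(r-k)\epsilon\bigr)^{1/2}\qquad\text{and}\qquad\frac{\|\mathbf X_t-\mathbf X_t^{(k)}\|}{\|\mathbf X_t\|}\le\Bigl(\frac{(r-k)\epsilon}{k\Delta}\Bigr)^{1/2},$$ where the last bound is read as $0$ if $k=r$. -/

import Mathlib

open MeasureTheory Filter Topology
open scoped ENNReal Matrix ComplexOrder

namespace RankReduction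

/-- The Hilbert space `L²_d(Ω, 𝓕, P)` of square integrable random vectors with values in `ℂ^d`;
its norm is `‖V‖² = E (V^* V)`. -/
noncomputable abbrev L2Vec {Ω : Type*} [MeasurableSpace Ω] (P : Measure Ω) (d : ℕ) : Type _ :=
  Lp (EuclideanSpace ℂ (Fin d)) 2 P

/-- The frequency interval `[-π, π]`. -/
abbrev freq : Set ℝ := Set.Icc (-Real.pi) Real.pi

/-- The matrix `E (V W^*)`. -/
noncomputable def crossCov {Ω : Type*} [MeasurableSpace Ω] {P : Measure Ω} {d : ℕ}
    (V W : L2Vec P d) : Matrix (Fin d) (Fin d) ℂ :=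
  Matrix.of fun a b => ∫ x, V x a * star (W x b) ∂P

/-- A (zero mean) weakly stationary `d`-dimensional time series. -/
structure IsStationary {Ω : Type*} [MeasurableSpace Ω] {P : Measure Ω} {d : ℕ}
    (X : ℤ → L2Vec P d) : Prop where
  mean_zero : ∀ t, ∫ x, X t x ∂P = 0
  cov_shift : ∀ s t h, crossCov (X (s + h)) (X s) = crossCov (X (t + h)) (X t)

/-- `f` is a spectral density of `X`: an integrable, a.e. non-negative definite matrix function
on `[-π, π]` with `E (X_{t+h} X_t^*) = ∫ e^{ihω} f(ω) dω` for all `t`, `h`. -/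
structure IsSpectralDensity {Ω : Type*} [MeasurableSpace Ω] {P : Measure Ω} {d : ℕ}
    (X : ℤ → L2Vec P d) (f : ℝ → Matrix (Fin d) (Fin d) ℂ) : Prop where
  integrable : ∀ a b, IntegrableOn (fun w => f w a b) freq
  posSemidef : ∀ᵐ w ∂(volume.restrict freq), (f w).PosSemidef
  cov_eq : ∀ (t h : ℤ) (a b : Fin d), crossCov (X (t + h)) (X t) a b =
    ∫ w in freq, Complex.exp (Complex.I * (h : ℂ) * (w : ℂ)) * f w a b

/-- A stationary time series of constant rank `r`: it has a spectral density, whose rank is `r`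
at almost every frequency. -/
def HasConstantRank {Ω : Type*} [MeasurableSpace Ω] {P : Measure Ω} {d : ℕ}
    (X : ℤ → L2Vec P d) (r : ℕ) : Prop :=
  IsStationary X ∧ ∃ f, IsSpectralDensity X f ∧ ∀ᵐ w ∂(volume.restrict freq), (f w).rank = r

/-- The random vector `A V` for a constant matrix `A`. -/
noncomputable def matAct {Ω : Type*} [MeasurableSpace Ω] {P : Measure Ω} {d : ℕ}
    (A : Matrix (Fin d) (Fin d) ℂ) (V : L2Vec P d) : L2Vec P d :=
  (Matrix.toEuclideanCLM (n := Fin d) (𝕜 := ℂ) A).compLp V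

/-- The integral `∫ S dZ = ∑_A A Z(S = A)` of a simple matrix valued function with respect to an
`L²_d`-valued measure. -/
noncomputable def simpleIntegral {Ω : Type*} [MeasurableSpace Ω] {P : Measure Ω} {d : ℕ}
    (Z : VectorMeasure ℝ (L2Vec P d)) (S : SimpleFunc ℝ (Matrix (Fin d) (Fin d) ℂ)) :
    L2Vec P d :=
  ∑ A ∈ S.range, matAct A (Z (S ⁻¹' {A}))

/-- The squared norm `tr ∫ G f G^* dω` on the space `L²(f)`. -/
noncomputable def specNormSq {d : ℕ} (f G : ℝ → Matrix (Fin d) (Fin d) ℂ) : ℝ≥0∞ :=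
  ∫⁻ w in freq, ENNReal.ofReal (Matrix.trace (G w * f w * (G w)ᴴ)).re

/-- `V = ∫ G dZ`, the stochastic integral of a measurable matrix function `G`: the limit in mean
square of the integrals of simple functions that converge to `G` in `L²(f)`. -/
def HasSpectralIntegral {Ω : Type*} [MeasurableSpace Ω] {P : Measure Ω} {d : ℕ}
    (f : ℝ → Matrix (Fin d) (Fin d) ℂ) (Z : VectorMeasure ℝ (L2Vec P d))
    (G : ℝ → Matrix (Fin d) (Fin d) ℂ) (V : L2Vec P d) : Prop :=
  (∀ a b, AEMeasurable (fun w => G w a b) (volume.restrict freq)) ∧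
  ∃ S : ℕ → SimpleFunc ℝ (Matrix (Fin d) (Fin d) ℂ),
    Tendsto (fun n => specNormSq f (fun w => G w - S n w)) atTop (𝓝 0) ∧
    Tendsto (fun n => simpleIntegral Z (S n)) atTop (𝓝 V)

/-- `Y_t = ∫ e^{itω} T(ω) dZ_ω` for all `t`: the process `Y` is obtained by the linear filter
with transfer function `T`. -/
def IsFiltered {Ω : Type*} [MeasurableSpace Ω] {P : Measure Ω} {d : ℕ}
    (f : ℝ → Matrix (Fin d) (Fin d) ℂ) (Z : VectorMeasure ℝ (L2Vec P d))
    (T : ℝ → Matrix (Fin d) (Fin d) ℂ) (Y : ℤ → L2Vec P d) : Prop :=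
  ∀ t : ℤ, HasSpectralIntegral f Z
    (fun w => Complex.exp (Complex.I * (t : ℂ) * (w : ℂ)) • T w) (Y t)

/-- `Z` is the random spectral measure in Cramér's representation `X_t = ∫ e^{itω} dZ_ω`
of the series `X` with spectral density `f`. -/
structure IsCramerMeasure {Ω : Type*} [MeasurableSpace Ω] {P : Measure Ω} {d : ℕ}
    (X : ℤ → L2Vec P d) (f : ℝ → Matrix (Fin d) (Fin d) ℂ)
    (Z : VectorMeasure ℝ (L2Vec P d)) : Prop where
  cov_eq : ∀ A B : Set ℝ, MeasurableSet A → MeasurableSet B → ∀ a b : Fin d,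
    crossCov (Z A) (Z B) a b = ∫ w in A ∩ B ∩ freq, f w a b
  represents : IsFiltered f Z (fun _ => 1) X

/-- A measurable spectral decomposition `f = U diag(λ_1, …, λ_r) U^*` a.e., where
`λ_1 ≥ ⋯ ≥ λ_r > 0 = λ_{r+1} = ⋯ = λ_d` are the eigenvalues (numbered from `1`) and the columns of
`U` are orthonormal. -/
structure IsSpectralDecomposition {d : ℕ} (r : ℕ) (f : ℝ → Matrix (Fin d) (Fin d) ℂ)
    (lam : ℕ → ℝ → ℝ) (U : ℝ → Matrix (Fin d) (Fin r) ℂ) : Prop where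
  measurable : ∀ a j, AEMeasurable (fun w => U w a j) (volume.restrict freq)
  antitone : ∀ᵐ w ∂(volume.restrict freq), ∀ i j, 1 ≤ i → i ≤ j → j ≤ r → lam j w ≤ lam i w
  pos : ∀ᵐ w ∂(volume.restrict freq), ∀ j, 1 ≤ j → j ≤ r → 0 < lam j w
  eq_zero : ∀ᵐ w ∂(volume.restrict freq), ∀ j, r < j → j ≤ d → lam j w = 0
  orthonormal : ∀ᵐ w ∂(volume.restrict freq), (U w)ᴴ * U w = 1
  decomp : ∀ᵐ w ∂(volume.restrict freq),
    f w = U w * Matrix.diagonal (fun i : Fin r => (lam (i.val + 1) w : ℂ)) * (U w)ᴴ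

/-- The first `k` columns of a matrix with `r` columns. -/
def firstCols {d r k : ℕ} (hk : k ≤ r) (U : Matrix (Fin d) (Fin r) ℂ) :
    Matrix (Fin d) (Fin k) ℂ :=
  U.submatrix id (Fin.castLE hk)

/-- The orthogonal projection `U_k U_k^*`, where `U_k` consists of the first `k` columns. -/
def projFilter {d r k : ℕ} (hk : k ≤ r) (U : ℝ → Matrix (Fin d) (Fin r) ℂ) :
    ℝ → Matrix (Fin d) (Fin d) ℂ :=
  fun w => firstCols hk (U w) * (firstCols hk (U w))ᴴ

end RankReduction

/-! Put M = U diag(√λ_1, …, √λ_r), so that f = M M^* and M(ω) is injective a.e. Sending a row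
function g to g M turns the inner product ∫ g' f g^* of L²(f) into that of the space `RowSpace r` of
square integrable ℂ^r-valued functions on [-π, π]. Injectivity of M makes the images of the rows
e^{itω} e_b, and likewise of the rows 1_A e_b, total there.

The covariance identities for X match Gram matrices, so e^{itω} e_b M ↦ (X_t)_b extends to an
isometry J into L²(P) (`exists_linearIsometry_of_inner_eq`). Evaluating J on indicators gives Z, and
totality of the exponentials gives uniqueness (`IsFactor.existsUnique_cramer`). Stochastic integrals
are J applied row by row (`IsFactor.hasSpectralIntegral_iff`). So a filter T yields a process with
spectral density T f T^* and ‖Y_t‖² = ∫ ‖T M‖_F² dω, where ‖·‖_F is the Frobenius norm.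

The error of a filter is therefore ∫ ‖M - T M‖_F² dω, and the problem decouples over frequencies. A
spectral density is determined a.e. by its Fourier coefficients, so either rank hypothesis gives
rank(T M) ≤ k a.e. Eckart–Young (`sum_tail_le_of_rank_le`) bounds the integrand below by λ_{k+1} + ⋯
+ λ_r, with equality for T = U_k U_k^*, because T M then consists of the first k columns of M,
padded by zeros. The bounds in (c) follow by integrating pointwise estimates over an interval of
length 2π. -/

namespace RankReduction

/-! ### Isometries from equal Gram matrices. -/

section Gram

/-- Two families of vectors with the same Gram matrix are related by a linear isometry, if the
first one is total. -/
theorem exists_linearIsometry_of_inner_eq {ι H K : Type*} [NormedAddCommGroup H]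
    [InnerProductSpace ℂ H] [NormedAddCommGroup K] [InnerProductSpace ℂ K] [CompleteSpace K]
    (φ : ι → H) (ψ : ι → K) (hin : ∀ i j, inner ℂ (φ i) (φ j) = inner ℂ (ψ i) (ψ j))
    (hd : (Submodule.span ℂ (Set.range φ)).topologicalClosure = ⊤) :
    ∃ J : H →ₗᵢ[ℂ] K, ∀ i, J (φ i) = ψ i := by
  set a := Finsupp.linearCombination ℂ φ
  set b := Finsupp.linearCombination ℂ ψ
  have hnorm : ∀ c, ‖b c‖ = ‖a c‖ := by
    intro c
    have h : inner ℂ (b c) (b c) = inner ℂ (a c) (a c) := by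
      simp only [a, b, Finsupp.linearCombination_apply, Finsupp.sum_inner, Finsupp.inner_sum,
        inner_smul_left, inner_smul_right, hin]
    rw [inner_self_eq_norm_sq_to_K, inner_self_eq_norm_sq_to_K] at h
    have h2 : ‖b c‖ ^ 2 = ‖a c‖ ^ 2 := by exact_mod_cast h
    exact (sq_eq_sq₀ (norm_nonneg _) (norm_nonneg _)).1 h2
  have hdense : DenseRange a := by
    have : Dense ((LinearMap.range a : Submodule ℂ H) : Set H) := by
      rw [Submodule.dense_iff_topologicalClosure_eq_top, Finsupp.range_linearCombination, hd]
    rwa [LinearMap.coe_range] at this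
  -- Equal norms force the kernel of `a` into that of `b`, so `b` descends to the range of `a`; as
  -- `K` is complete, it extends from this dense range to `H`.
  have hext := LinearMap.extendOfNorm_eq (f := b) (e := a) hdense ⟨1, fun c => by simp [hnorm]⟩
  refine ⟨⟨(b.extendOfNorm a).toLinearMap, ?_⟩, fun i => ?_⟩
  · intro x
    refine hdense.induction (P := fun x => ‖b.extendOfNorm a x‖ = ‖x‖) ?_
      (isClosed_eq (by fun_prop) (by fun_prop)) x
    rintro _ ⟨c, rfl⟩
    rw [hext, hnorm]
  · have := hext (Finsupp.single i 1)
    simpa [a, b] using this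

/-- Continuous linear maps that agree on a total family are equal. -/
theorem eq_of_eq_on_total {ι H K : Type*} [NormedAddCommGroup H]
    [InnerProductSpace ℂ H] [NormedAddCommGroup K] [InnerProductSpace ℂ K]
    {φ : ι → H} (hd : (Submodule.span ℂ (Set.range φ)).topologicalClosure = ⊤)
    {J J' : H →ₗᵢ[ℂ] K} (h : ∀ i, J (φ i) = J' (φ i)) : J = J' := by
  have : J.toContinuousLinearMap = J'.toContinuousLinearMap := by
    refine ContinuousLinearMap.ext_on (s := Set.range φ) ?_ ?_
    · rwa [Submodule.dense_iff_topologicalClosure_eq_top]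
    · rintro _ ⟨i, rfl⟩
      exact h i
  ext x
  exact congrArg (fun L : H →L[ℂ] K => L x) this

end Gram

/-! ### Uniqueness of Fourier coefficients for integrable functions. -/

section Fourier

/-- An integrable function on `[-π, π]` with vanishing Fourier coefficients vanishes a.e. -/
theorem ae_eq_zero_of_fourier_eq_zero {h : ℝ → ℂ} (hh : IntegrableOn h freq)
    (hz : ∀ t : ℤ, ∫ w in freq, Complex.exp (Complex.I * (t : ℂ) * (w : ℂ)) * h w = 0) :
    ∀ᵐ w ∂(volume.restrict freq), h w = 0 := by
  have : Fact (0 < 2 * Real.pi) := ⟨Real.two_pi_pos⟩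
  have hclosed : ∀ F : C(AddCircle (2 * Real.pi), ℂ),
      ∫ w in freq, F (w : AddCircle (2 * Real.pi)) * h w = 0 := by
    have hint : ∀ F : C(AddCircle (2 * Real.pi), ℂ),
        IntegrableOn (fun w : ℝ => F (w : AddCircle (2 * Real.pi)) * h w) freq := by
      intro F
      refine Integrable.bdd_mul (c := ‖F‖) hh ?_ ?_
      · have : Continuous fun w : ℝ => F (w : AddCircle (2 * Real.pi)) :=
          F.continuous.comp (AddCircle.continuous_mk' _)
        exact this.aestronglyMeasurable
      · exact ae_of_all _ fun w => F.norm_coe_le_norm _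
    let Λ : C(AddCircle (2 * Real.pi), ℂ) →ₗ[ℂ] ℂ :=
      { toFun := fun F => ∫ w in freq, F (w : AddCircle (2 * Real.pi)) * h w
        map_add' := fun F G => by
          simp only [ContinuousMap.add_apply, add_mul]
          exact integral_add (hint F) (hint G)
        map_smul' := fun c F => by
          simp only [ContinuousMap.smul_apply, smul_eq_mul, mul_assoc, RingHom.id_apply]
          exact integral_const_mul _ _ }
    have hb : ∀ F, ‖Λ F‖ ≤ (∫ w in freq, ‖h w‖) * ‖F‖ := by
      intro F
      calc ‖Λ F‖ ≤ ∫ w in freq, ‖F (w : AddCircle (2 * Real.pi)) * h w‖ :=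
            norm_integral_le_integral_norm _
        _ ≤ ∫ w in freq, ‖h w‖ * ‖F‖ := by
            refine integral_mono (hint F).norm (hh.norm.mul_const _) fun w => ?_
            simp only [norm_mul]
            rw [mul_comm]
            exact mul_le_mul_of_nonneg_left (F.norm_coe_le_norm _) (norm_nonneg _)
        _ = _ := integral_mul_const _ _
    -- Integration against `h` is bounded in the sup norm and kills every Fourier monomial;
    -- trigonometric polynomials are dense in the continuous functions on the circle.
    have hΛ : Λ.mkContinuous _ hb = 0 := by
      refine ContinuousLinearMap.ext_on (s := Set.range (@fourier (2 * Real.pi))) ?_ ?_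
      · rw [Submodule.dense_iff_topologicalClosure_eq_top, span_fourier_closure_eq_top]
      · rintro _ ⟨n, rfl⟩
        have := hz n
        simp only [LinearMap.mkContinuous_apply, zero_apply]
        rw [← this]
        refine integral_congr_ae (ae_of_all _ fun w => ?_)
        simp only [fourier_coe_apply]
        congr 2
        have : (Real.pi : ℂ) ≠ 0 := by exact_mod_cast Real.pi_ne_zero
        push_cast
        field_simp
    intro F
    exact congrArg (fun L : C(AddCircle (2 * Real.pi), ℂ) →L[ℂ] ℂ => L F) hΛ
  have hopen : ∀ᵐ w : ℝ, w ∈ Set.Ioo (-Real.pi) Real.pi → h w = 0 := by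
    refine IsOpen.ae_eq_zero_of_integral_contDiff_smul_eq_zero isOpen_Ioo
      (hh.mono_set Set.Ioo_subset_Icc_self).locallyIntegrableOn ?_
    intro g hg _ hsupp
    have hg0 : ∀ w, w ∉ Set.Ioo (-Real.pi) Real.pi → g w = 0 := fun w hw =>
      image_eq_zero_of_notMem_tsupport fun h' => hw (hsupp h')
    -- A test function supported in the open interval vanishes at both endpoints, so it descends to
    -- a continuous function on the circle.
    have hend : (fun w => (g w : ℂ)) (-Real.pi) = (fun w => (g w : ℂ)) (-Real.pi + 2 * Real.pi) := by
      simp only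
      rw [hg0 _ (by simp), hg0 _ fun h' => by linarith [h'.2]]
    have hcont := AddCircle.liftIco_continuous (p := 2 * Real.pi) hend
      (Complex.continuous_ofReal.comp hg.continuous).continuousOn
    have h0 := hclosed ⟨_, hcont⟩
    have e1 : ∫ w, g w • h w = ∫ w in freq, g w • h w := by
      symm
      refine setIntegral_eq_integral_of_forall_compl_eq_zero fun w hw => ?_
      rw [hg0 w fun h' => hw (Set.Ioo_subset_Icc_self h'), zero_smul]
    rw [e1, ← h0, integral_Icc_eq_integral_Ico, integral_Icc_eq_integral_Ico]
    refine setIntegral_congr_fun measurableSet_Ico fun w hw => ?_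
    simp only [ContinuousMap.coe_mk]
    rw [AddCircle.liftIco_coe_apply (by convert hw using 2; ring)]
    simp
  rw [show freq = Set.Icc (-Real.pi) Real.pi from rfl, ← restrict_Ioo_eq_restrict_Icc,
    ae_restrict_iff' measurableSet_Ioo]
  exact hopen

end Fourier

/-! ### Eckart–Young by projection onto a column space. -/

section LowRank

/-- A weighted sum with weights in `[0, 1]` of total mass at most `k` is at most the sum of the
`k` largest terms. -/
theorem sum_mul_le_sum_first {r k : ℕ} (hk : 1 ≤ k) (hkr : k ≤ r) {l p : Fin r → ℝ}
    (hl0 : ∀ j, 0 ≤ l j) (hl : Antitone l) (hp0 : ∀ j, 0 ≤ p j) (hp1 : ∀ j, p j ≤ 1)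
    (hp : ∑ j, p j ≤ k) :
    ∑ j, l j * p j ≤ ∑ j : Fin r with j.val < k, l j := by
  -- `c` is the k-th largest term (indices start at 0). After subtracting it, the first k terms are
  -- nonnegative and the others nonpositive, so the weights 1 and 0 are best; the remainder is
  -- controlled by c ∑ p ≤ c k, which needs c ≥ 0.
  set c := l ⟨k - 1, by omega⟩
  have hc0 : 0 ≤ c := hl0 _
  have hcard : ((Finset.univ.filter fun j : Fin r => j.val < k).card : ℝ) = k := by
    rw [Fin.card_filter_val_lt, min_eq_right hkr]
  have h1 : ∑ j, (l j - c) * p j ≤ ∑ j : Fin r with j.val < k, (l j - c) := by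
    rw [Finset.sum_filter]
    refine Finset.sum_le_sum fun j _ => ?_
    split_ifs with hj
    · have : c ≤ l j := hl (by rw [Fin.le_def]; simp only; omega)
      nlinarith [hp0 j, hp1 j]
    · have : l j ≤ c := hl (by rw [Fin.le_def]; simp only; omega)
      nlinarith [hp0 j, hp1 j]
  have h2 : ∑ j, (l j - c) * p j = ∑ j, l j * p j - c * ∑ j, p j := by
    simp only [sub_mul, Finset.sum_sub_distrib, Finset.mul_sum]
  rw [Finset.sum_sub_distrib, Finset.sum_const, nsmul_eq_mul, hcard] at h1
  nlinarith

variable {E : Type*} [NormedAddCommGroup E] [InnerProductSpace ℂ E]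

/-- Expand each projection in an orthonormal basis of `W`, swap the sums, and apply Bessel's
inequality for `u` to each basis vector. -/
theorem sum_norm_sq_starProjection_le {r : ℕ} {u : Fin r → E} (hu : Orthonormal ℂ u)
    (W : Submodule ℂ E) [FiniteDimensional ℂ W] :
    ∑ j, ‖W.starProjection (u j)‖ ^ 2 ≤ Module.finrank ℂ W := by
  set b := stdOrthonormalBasis ℂ W
  have h : ∀ j, ‖W.starProjection (u j)‖ ^ 2 = ∑ i, ‖inner ℂ (u j) (b i : E)‖ ^ 2 := by
    intro j
    have := b.sum_sq_norm_inner_right (W.orthogonalProjectionOnto (u j))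
    rw [Submodule.starProjection_apply, ← Submodule.coe_norm, ← this]
    refine Finset.sum_congr rfl fun i _ => ?_
    rw [Submodule.inner_orthogonalProjectionOnto_eq_of_mem_left, norm_inner_symm]
  simp only [h]
  rw [Finset.sum_comm]
  calc ∑ i, ∑ j, ‖inner ℂ (u j) (b i : E)‖ ^ 2 ≤ ∑ i, ‖(b i : E)‖ ^ 2 :=
        Finset.sum_le_sum fun i _ => hu.sum_inner_products_le _
    _ = Module.finrank ℂ W := by simp [← Submodule.coe_norm]

/-- The left side is the squared norm of the component of x in the orthogonal complement of `W`, and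
subtracting `w` does not change that component. -/
theorem norm_sq_sub_norm_sq_starProjection_le (W : Submodule ℂ E) [FiniteDimensional ℂ W]
    (x : E) {w : E} (hw : w ∈ W) : ‖x‖ ^ 2 - ‖W.starProjection x‖ ^ 2 ≤ ‖x - w‖ ^ 2 := by
  have h1 := W.norm_sq_eq_add_norm_sq_starProjection x
  have h2 := W.norm_sq_eq_add_norm_sq_starProjection (x - w)
  have h3 : Wᗮ.starProjection (x - w) = Wᗮ.starProjection x := by
    rw [map_sub, (Submodule.starProjection_apply_eq_zero_iff _).2
      (W.le_orthogonal_orthogonal hw), sub_zero]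
  rw [h3] at h2
  nlinarith [sq_nonneg ‖W.starProjection (x - w)‖]

/-- The columns of a matrix with orthonormal columns. -/
theorem orthonormal_cols {d r : ℕ} {U : Matrix (Fin d) (Fin r) ℂ} (hU : Uᴴ * U = 1) :
    Orthonormal ℂ fun j => (WithLp.toLp 2 fun a => U a j : EuclideanSpace ℂ (Fin d)) := by
  rw [orthonormal_iff_ite]
  intro i j
  have := congrFun (congrFun hU i) j
  rw [Matrix.mul_apply, Matrix.one_apply] at this
  rw [← this]
  simp [PiLp.inner_apply, mul_comm]

/-- **Eckart–Young** in the Frobenius norm. -/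
theorem sum_tail_le_of_rank_le {d r k : ℕ} (hk : 1 ≤ k) (hkr : k ≤ r)
    {U : Matrix (Fin d) (Fin r) ℂ} (hU : Uᴴ * U = 1) {l : Fin r → ℝ} (hl0 : ∀ j, 0 ≤ l j)
    (hl : Antitone l) {B : Matrix (Fin d) (Fin r) ℂ} (hB : B.rank ≤ k) :
    ∑ j : Fin r with k ≤ j.val, l j ≤
      ∑ a, ∑ j, ‖(U * Matrix.diagonal (fun j : Fin r => ((Real.sqrt (l j) : ℝ) : ℂ)) - B) a j‖ ^ 2 := by
  set u : Fin r → EuclideanSpace ℂ (Fin d) := fun j => WithLp.toLp 2 fun a => U a j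
  set v : Fin r → EuclideanSpace ℂ (Fin d) := fun j => WithLp.toLp 2 fun a => B a j
  have hu : Orthonormal ℂ u := orthonormal_cols hU
  set W := Submodule.span ℂ (Set.range v)
  have hW : Module.finrank ℂ W ≤ k := by
    refine le_trans (le_of_eq ?_) hB
    rw [Matrix.rank_eq_finrank_span_cols,
      ← LinearEquiv.finrank_map_eq (WithLp.linearEquiv 2 ℂ (Fin d → ℂ)).symm, Submodule.map_span,
      ← Set.range_comp]
    rfl
  set p : Fin r → ℝ := fun j => ‖W.starProjection (u j)‖ ^ 2
  have hp1 : ∀ j, p j ≤ 1 := by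
    intro j
    have := W.norm_sq_eq_add_norm_sq_starProjection (u j)
    rw [hu.1 j] at this
    nlinarith [sq_nonneg ‖Wᗮ.starProjection (u j)‖]
  have hp : ∑ j, p j ≤ k :=
    (sum_norm_sq_starProjection_le hu W).trans (by exact_mod_cast hW)
  have hsum := sum_mul_le_sum_first hk hkr hl0 hl (fun j => sq_nonneg _) hp1 hp
  have hcol : ∀ j, l j - l j * p j ≤ ∑ a,
      ‖(U * Matrix.diagonal (fun j : Fin r => ((Real.sqrt (l j) : ℝ) : ℂ)) - B) a j‖ ^ 2 := by
    intro j
    -- Column j of `B` is one point of `W`, so its squared distance from √l_j u_j is at least that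
    -- of `W`, namely l_j (1 - p_j).
    have h := norm_sq_sub_norm_sq_starProjection_le W ((Real.sqrt (l j) : ℂ) • u j) (w := v j)
      (Submodule.subset_span ⟨j, rfl⟩)
    rw [map_smul, norm_smul, norm_smul, hu.1 j, mul_pow, mul_pow, Complex.norm_real,
      Real.norm_eq_abs, sq_abs, Real.sq_sqrt (hl0 j)] at h
    refine le_trans (le_of_eq (by simp [p])) (h.trans (le_of_eq ?_))
    rw [EuclideanSpace.norm_sq_eq]
    refine Finset.sum_congr rfl fun a _ => ?_
    simp [u, v, Matrix.mul_diagonal, mul_comm]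
  rw [Finset.sum_comm]
  refine le_trans ?_ (Finset.sum_le_sum fun j _ => hcol j)
  rw [Finset.sum_sub_distrib]
  have := Finset.sum_filter_add_sum_filter_not Finset.univ (fun j : Fin r => j.val < k) l
  simp only [not_lt] at this
  linarith

end LowRank

/-! ### Random vectors through their scalar components. -/

section Components

variable {Ω : Type*} [MeasurableSpace Ω] {P : Measure Ω} {d : ℕ}

/-- The components of a square integrable random vector. -/
noncomputable def comp (a : Fin d) : L2Vec P d →L[ℂ] Lp ℂ 2 P :=
  (EuclideanSpace.proj a : EuclideanSpace ℂ (Fin d) →L[ℂ] ℂ).compLpL 2 P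

theorem coeFn_comp (a : Fin d) (V : L2Vec P d) : comp a V =ᵐ[P] fun x => V x a :=
  ContinuousLinearMap.coeFn_compLpL _ V

theorem ext_comp {V W : L2Vec P d} (h : ∀ a, comp a V = comp a W) : V = W := by
  refine Lp.ext ?_
  have hall : ∀ᵐ x ∂P, ∀ a, V x a = W x a := by
    rw [ae_all_iff]
    intro a
    filter_upwards [coeFn_comp a V, coeFn_comp a W] with x h1 h2
    rw [← h1, ← h2, h a]
  filter_upwards [hall] with x hx
  ext a
  exact hx a

theorem crossCov_apply (V W : L2Vec P d) (a b : Fin d) :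
    crossCov V W a b = inner ℂ (comp b W) (comp a V) := by
  rw [L2.inner_def]
  refine integral_congr_ae ?_
  filter_upwards [coeFn_comp a V, coeFn_comp b W] with x h1 h2
  rw [h1, h2]
  simp

theorem norm_sq_eq_sum_comp (V : L2Vec P d) : ‖V‖ ^ 2 = ∑ a, ‖comp a V‖ ^ 2 := by
  have h : inner ℂ V V = ∑ a, inner ℂ (comp a V) (comp a V) := by
    simp only [L2.inner_def]
    rw [← integral_finsetSum _ fun a _ => L2.integrable_inner _ _]
    refine integral_congr_ae ?_
    have hall : ∀ᵐ x ∂P, ∀ a, comp a V x = V x a := ae_all_iff.2 fun a => coeFn_comp a V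
    filter_upwards [hall] with x hx
    rw [PiLp.inner_apply]
    simp only [hx]
  simp only [inner_self_eq_norm_sq_to_K] at h
  exact_mod_cast h

/-- The random vector with given components. -/
noncomputable def ofComp (v : Fin d → Lp ℂ 2 P) : L2Vec P d :=
  ∑ a, (ContinuousLinearMap.toSpanSingleton ℂ
    (EuclideanSpace.single a 1 : EuclideanSpace ℂ (Fin d))).compLpL 2 P (v a)

@[simp]
theorem comp_ofComp (v : Fin d → Lp ℂ 2 P) (a : Fin d) : comp a (ofComp v) = v a := by
  rw [ofComp, map_sum, Finset.sum_eq_single a]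
  · refine Lp.ext ?_
    refine (ContinuousLinearMap.coeFn_compLpL _ _).trans ?_
    filter_upwards [ContinuousLinearMap.coeFn_compLpL (ContinuousLinearMap.toSpanSingleton ℂ
      (EuclideanSpace.single a 1 : EuclideanSpace ℂ (Fin d))) (v a)] with x hx
    rw [hx]
    simp
  · intro b _ hb
    refine Lp.ext ?_
    refine (ContinuousLinearMap.coeFn_compLpL _ _).trans ?_
    filter_upwards [ContinuousLinearMap.coeFn_compLpL (ContinuousLinearMap.toSpanSingleton ℂ
      (EuclideanSpace.single b 1 : EuclideanSpace ℂ (Fin d))) (v b),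
      Lp.coeFn_zero ℂ 2 P] with x hx h0
    rw [hx, h0]
    simp [hb.symm]
  · simp

theorem comp_matAct (A : Matrix (Fin d) (Fin d) ℂ) (V : L2Vec P d) (a : Fin d) :
    comp a (matAct A V) = ∑ b, A a b • comp b V := by
  refine Lp.ext ?_
  have hall : ∀ᵐ x ∂P, ∀ b, (A a b • comp b V) x = A a b * V x b := by
    rw [ae_all_iff]
    intro b
    filter_upwards [Lp.coeFn_smul (A a b) (comp b V), coeFn_comp b V] with x h1 h2
    rw [h1, Pi.smul_apply, h2, smul_eq_mul]
  filter_upwards [coeFn_comp a (matAct A V),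
    ContinuousLinearMap.coeFn_compLp (Matrix.toEuclideanCLM (n := Fin d) (𝕜 := ℂ) A) V,
    Lp.coeFn_fun_finsetSum Finset.univ (fun b => A a b • comp b V), hall] with x h1 h2 h3 h4
  rw [h1, h3, matAct, h2]
  simp [h4, Matrix.mulVec, dotProduct]

theorem tendsto_comp_iff {v : ℕ → L2Vec P d} {V : L2Vec P d} :
    Tendsto v atTop (𝓝 V) ↔ ∀ a, Tendsto (fun n => comp a (v n)) atTop (𝓝 (comp a V)) := by
  refine ⟨fun h a => ((comp a).continuous.tendsto V).comp h, fun h => ?_⟩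
  rw [tendsto_iff_norm_sub_tendsto_zero]
  have h1 : Tendsto (fun n => ‖v n - V‖ ^ 2) atTop (𝓝 0) := by
    simp only [norm_sq_eq_sum_comp, map_sub]
    have : Tendsto (fun n => ∑ a, ‖comp a (v n) - comp a V‖ ^ 2) atTop
        (𝓝 (∑ _a : Fin d, (0 : ℝ) ^ 2)) :=
      tendsto_finsetSum _ fun a _ => (tendsto_iff_norm_sub_tendsto_zero.1 (h a)).pow 2
    simpa using this
  have h2 := h1.sqrt
  simpa [Real.sqrt_sq (norm_nonneg _)] using h2

end Components

/-! ### The row space as a model of L²(f), and its total families. -/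

section Model

/-- Lebesgue measure on the frequency interval. -/
noncomputable abbrev freqMeasure : Measure ℝ := volume.restrict freq

/-- A square integrable factorization `f = M M^*` with injective `M`. -/
structure IsFactor {d r : ℕ} (f : ℝ → Matrix (Fin d) (Fin d) ℂ)
    (M : ℝ → Matrix (Fin d) (Fin r) ℂ) : Prop where
  memLp : ∀ a j, MemLp (fun w => M w a j) 2 freqMeasure
  eq : ∀ᵐ w ∂freqMeasure, f w = M w * (M w)ᴴ
  inj : ∀ᵐ w ∂freqMeasure, ∀ v, M w *ᵥ v = 0 → v = 0

/-- The row vector function `g M`. -/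
noncomputable def rowMul {d r : ℕ} (M : ℝ → Matrix (Fin d) (Fin r) ℂ) (g : ℝ → Fin d → ℂ) :
    ℝ → EuclideanSpace ℂ (Fin r) :=
  fun w => WithLp.toLp 2 (g w ᵥ* M w)

/-- The Hilbert space that is the image of the rows of `L²(f)` under `g ↦ g M`. -/
noncomputable abbrev RowSpace (r : ℕ) : Type := Lp (EuclideanSpace ℂ (Fin r)) 2 freqMeasure

variable {d r : ℕ} {f : ℝ → Matrix (Fin d) (Fin d) ℂ} {M : ℝ → Matrix (Fin d) (Fin r) ℂ}

theorem IsFactor.aestronglyMeasurable_rowMul (hM : IsFactor f M) {g : ℝ → Fin d → ℂ}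
    (hg : ∀ b, AEMeasurable (fun w => g w b) freqMeasure) :
    AEStronglyMeasurable (rowMul M g) freqMeasure := by
  refine AEMeasurable.aestronglyMeasurable
    ((WithLp.measurable_toLp 2 (Fin r → ℂ)).comp_aemeasurable ?_)
  refine aemeasurable_pi_lambda _ fun j => ?_
  simp only [Matrix.vecMul, dotProduct]
  exact Finset.aemeasurable_fun_sum _ fun b _ =>
    (hg b).mul (hM.memLp b j).aestronglyMeasurable.aemeasurable

theorem IsFactor.memLp_rowMul (hM : IsFactor f M) {g : ℝ → Fin d → ℂ}
    (hg : ∀ b, MemLp (fun w => g w b) ∞ freqMeasure) : MemLp (rowMul M g) 2 freqMeasure := by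
  refine MemLp.of_eval_piLp fun j => ?_
  simp only [rowMul, Matrix.vecMul, dotProduct]
  exact memLp_finsetSum _ fun b _ => MemLp.mul (p := ∞) (q := 2) (hM.memLp b j) (hg b)

theorem rowMul_add (g g' : ℝ → Fin d → ℂ) : rowMul M (g + g') = rowMul M g + rowMul M g' := by
  funext w
  simp [rowMul, Matrix.add_vecMul]

theorem rowMul_sub (g g' : ℝ → Fin d → ℂ) : rowMul M (g - g') = rowMul M g - rowMul M g' := by
  funext w
  simp [rowMul, Matrix.sub_vecMul]

theorem rowMul_smul (c : ℂ) (g : ℝ → Fin d → ℂ) : rowMul M (c • g) = c • rowMul M g := by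
  funext w
  simp [rowMul, Matrix.smul_vecMul]

theorem inner_rowMul (g g' : ℝ → Fin d → ℂ) (w : ℝ) :
    inner ℂ (rowMul M g w) (rowMul M g' w) = g' w ⬝ᵥ (M w * (M w)ᴴ) *ᵥ star (g w) := by
  rw [EuclideanSpace.inner_eq_star_dotProduct]
  simp only [rowMul]
  rw [Matrix.star_vecMul, Matrix.dotProduct_mulVec, Matrix.dotProduct_mulVec,
    ← Matrix.vecMul_vecMul]

theorem IsFactor.inner_toLp (hM : IsFactor f M) {g g' : ℝ → Fin d → ℂ}
    (hg : MemLp (rowMul M g) 2 freqMeasure) (hg' : MemLp (rowMul M g') 2 freqMeasure) :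
    inner ℂ (hg.toLp _) (hg'.toLp _) = ∫ w in freq, g' w ⬝ᵥ f w *ᵥ star (g w) := by
  rw [L2.inner_def]
  refine integral_congr_ae ?_
  filter_upwards [hg.coeFn_toLp, hg'.coeFn_toLp, hM.eq] with w h1 h2 h3
  rw [h1, h2, h3, inner_rowMul]

theorem IsFactor.integrable_form (hM : IsFactor f M) {g g' : ℝ → Fin d → ℂ}
    (hg : MemLp (rowMul M g) 2 freqMeasure) (hg' : MemLp (rowMul M g') 2 freqMeasure) :
    IntegrableOn (fun w => g' w ⬝ᵥ f w *ᵥ star (g w)) freq := by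
  refine (L2.integrable_inner (𝕜 := ℂ) (hg.toLp _) (hg'.toLp _)).congr ?_
  filter_upwards [hg.coeFn_toLp, hg'.coeFn_toLp, hM.eq] with w h1 h2 h3
  rw [h1, h2, h3, inner_rowMul]

theorem IsFactor.memLp_single (hM : IsFactor f M) {φ : ℝ → ℂ} (hφ : MemLp φ ∞ freqMeasure)
    (b : Fin d) : MemLp (rowMul M fun w => Pi.single b (φ w)) 2 freqMeasure := by
  refine hM.memLp_rowMul fun b' => ?_
  rcases eq_or_ne b' b with rfl | hb
  · simpa using hφ
  · simp [hb]

/-- For indicators this is the covariance of `Z`, for exponentials the autocovariance of `X`; both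
isometries are built on it. -/
theorem IsFactor.inner_single (hM : IsFactor f M) {φ φ' : ℝ → ℂ} (hφ : MemLp φ ∞ freqMeasure)
    (hφ' : MemLp φ' ∞ freqMeasure) (a b : Fin d) :
    inner ℂ ((hM.memLp_single hφ b).toLp _) ((hM.memLp_single hφ' a).toLp _) =
      ∫ w in freq, φ' w * star (φ w) * f w a b := by
  rw [hM.inner_toLp]
  congr 1
  funext w
  rw [single_dotProduct, ← Pi.single_star, Matrix.mulVec_single]
  simp
  ring

/-- Products of the rows of `M` with a separating family of bounded functions are total. -/
theorem IsFactor.total_of_separating (hM : IsFactor f M) {ι : Type*} {φ : ι → ℝ → ℂ}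
    (hφ : ∀ i, MemLp (φ i) ∞ freqMeasure)
    (hsep : ∀ h : ℝ → ℂ, IntegrableOn h freq → (∀ i, ∫ w in freq, star (φ i w) * h w = 0) →
      ∀ᵐ w ∂freqMeasure, h w = 0) :
    (Submodule.span ℂ (Set.range fun p : ι × Fin d =>
      (hM.memLp_single (hφ p.1) p.2).toLp _)).topologicalClosure = ⊤ := by
  rw [Submodule.topologicalClosure_eq_top_iff, Submodule.eq_bot_iff]
  intro h hh
  rw [Submodule.mem_orthogonal] at hh
  -- Orthogonality of `h` to all φ_i e_b M says that entry b of conj(M) h, an integrable function,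
  -- has zero moments against the separating family.
  have hz : ∀ b, ∀ᵐ w ∂freqMeasure, ∑ j, star (M w b j) * h w j = 0 := by
    intro b
    refine hsep _ (integrable_finsetSum _ fun j _ => ?_) fun i => ?_
    · exact MemLp.integrable_mul (p := 2) (q := 2) (hM.memLp b j).star
        ((Lp.memLp h).eval_piLp j)
    · have h0 := hh _ (Submodule.subset_span ⟨(i, b), rfl⟩)
      rw [L2.inner_def] at h0
      rw [← h0]
      refine integral_congr_ae ?_
      filter_upwards [(hM.memLp_single (hφ i) b).coeFn_toLp] with w hw
      rw [hw, EuclideanSpace.inner_eq_star_dotProduct]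
      simp only [rowMul, Matrix.single_vecMul, dotProduct, Finset.mul_sum]
      refine Finset.sum_congr rfl fun j _ => ?_
      simp [Matrix.row]
      ring
  rw [← ae_all_iff] at hz
  refine Lp.ext ?_
  filter_upwards [hz, hM.inj, Lp.coeFn_zero (EuclideanSpace ℂ (Fin r)) 2 freqMeasure]
    with w h1 h2 h3
  -- Conjugation turns conj(M) h = 0 into M conj(h) = 0, to which injectivity of M applies.
  have h4 := h2 (star (h w).ofLp) (by
    funext b
    have := congrArg star (h1 b)
    simpa [Matrix.mulVec, dotProduct, mul_comm] using this)
  rw [h3]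
  ext j
  have := congrFun h4 j
  simpa using this

theorem memLp_indicator_one {A : Set ℝ} (hA : MeasurableSet A) :
    MemLp (A.indicator (1 : ℝ → ℂ)) ∞ freqMeasure :=
  MemLp.indicator hA (MemLp.of_bound aestronglyMeasurable_one 1 (by simp))

theorem memLp_exp (t : ℤ) :
    MemLp (fun w : ℝ => Complex.exp (Complex.I * (t : ℂ) * (w : ℂ))) ∞ freqMeasure := by
  refine MemLp.of_bound (Continuous.aestronglyMeasurable (by fun_prop)) 1 (ae_of_all _ fun w => ?_)
  rw [Complex.norm_exp]
  simp

theorem star_exp (t : ℤ) (w : ℝ) : star (Complex.exp (Complex.I * (t : ℂ) * (w : ℂ))) =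
    Complex.exp (Complex.I * ((-t : ℤ) : ℂ) * (w : ℂ)) := by
  rw [Complex.star_def, ← Complex.exp_conj]
  simp

theorem exp_mul_star_exp (s t : ℤ) (w : ℝ) :
    Complex.exp (Complex.I * (s : ℂ) * (w : ℂ)) *
      star (Complex.exp (Complex.I * (t : ℂ) * (w : ℂ))) =
    Complex.exp (Complex.I * ((s - t : ℤ) : ℂ) * (w : ℂ)) := by
  rw [star_exp, ← Complex.exp_add]
  congr 1
  push_cast
  ring

theorem IsFactor.total_indicator (hM : IsFactor f M) :
    (Submodule.span ℂ (Set.range fun p : {A : Set ℝ // MeasurableSet A} × Fin d =>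
      (hM.memLp_single (memLp_indicator_one p.1.2) p.2).toLp _)).topologicalClosure = ⊤ := by
  refine hM.total_of_separating (φ := fun A : {A : Set ℝ // MeasurableSet A} =>
    (A : Set ℝ).indicator (1 : ℝ → ℂ)) (fun A => memLp_indicator_one A.2) fun h hh h0 => ?_
  refine hh.ae_eq_zero_of_forall_setIntegral_eq_zero fun A hA _ => ?_
  have := h0 ⟨A, hA⟩
  rw [← integral_indicator hA, ← this]
  congr 1
  funext w
  by_cases hw : w ∈ A <;> simp [hw]

/-- The Fourier uniqueness theorem is what separates here. This totality is why the values of `X`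
determine `Z`. -/
theorem IsFactor.total_exp (hM : IsFactor f M) :
    (Submodule.span ℂ (Set.range fun p : ℤ × Fin d =>
      (hM.memLp_single (memLp_exp p.1) p.2).toLp _)).topologicalClosure = ⊤ := by
  refine hM.total_of_separating memLp_exp fun h hh h0 => ?_
  refine ae_eq_zero_of_fourier_eq_zero hh fun t => ?_
  have := h0 (-t)
  simpa only [star_exp, neg_neg] using this

theorem IsFactor.memLp_simple (hM : IsFactor f M) (s : SimpleFunc ℝ (Fin d → ℂ)) :
    MemLp (rowMul M s) 2 freqMeasure :=
  hM.memLp_rowMul fun b => SimpleFunc.memLp_top (s.map fun v : Fin d → ℂ => v b) freqMeasure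

/-- Simple row functions are dense in the row space. -/
theorem IsFactor.exists_simple_norm_sub_lt (hM : IsFactor f M) (h : RowSpace r) {ε : ℝ}
    (hε : 0 < ε) : ∃ s : SimpleFunc ℝ (Fin d → ℂ), ‖(hM.memLp_simple s).toLp _ - h‖ < ε := by
  -- The images of simple rows form a subspace containing the total family of indicators, so its
  -- closure is everything.
  let N : Submodule ℂ (RowSpace r) :=
    { carrier := {x | ∃ s : SimpleFunc ℝ (Fin d → ℂ), (hM.memLp_simple s).toLp _ = x}
      add_mem' := by
        rintro _ _ ⟨s, rfl⟩ ⟨s', rfl⟩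
        refine ⟨s + s', ?_⟩
        rw [← MemLp.toLp_add, MemLp.toLp_eq_toLp_iff, SimpleFunc.coe_add, rowMul_add]
      zero_mem' := by
        refine ⟨0, (Lp.eq_zero_iff_ae_eq_zero).2 ((MemLp.coeFn_toLp _).trans ?_)⟩
        refine ae_of_all _ fun w => ?_
        simp [rowMul]
      smul_mem' := by
        rintro c _ ⟨s, rfl⟩
        refine ⟨c • s, Eq.trans ?_ (MemLp.toLp_const_smul c (hM.memLp_simple s))⟩
        exact MemLp.toLp_congr _ _ (by rw [SimpleFunc.coe_smul, rowMul_smul]) }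
  have hle : Submodule.span ℂ (Set.range fun p : {A : Set ℝ // MeasurableSet A} × Fin d =>
      (hM.memLp_single (memLp_indicator_one p.1.2) p.2).toLp _) ≤ N := by
    rw [Submodule.span_le]
    rintro _ ⟨⟨⟨A, hA⟩, b⟩, rfl⟩
    refine ⟨SimpleFunc.piecewise A hA (SimpleFunc.const ℝ (Pi.single b 1)) 0, ?_⟩
    rw [MemLp.toLp_eq_toLp_iff]
    refine ae_of_all _ fun w => ?_
    by_cases hw : w ∈ A <;> simp [rowMul, hw]
  have hN : h ∈ N.topologicalClosure := by
    refine Submodule.topologicalClosure_mono hle ?_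
    rw [hM.total_indicator]
    trivial
  obtain ⟨_, ⟨s, rfl⟩, hs⟩ := Metric.mem_closure_iff.1 hN ε hε
  refine ⟨s, ?_⟩
  rwa [dist_comm, dist_eq_norm] at hs

end Model

/-! ### The norm of L²(f) computed row by row. -/

section SpectralNorm

variable {d r : ℕ} {f : ℝ → Matrix (Fin d) (Fin d) ℂ} {M : ℝ → Matrix (Fin d) (Fin r) ℂ}

theorem norm_sq_rowMul (g : ℝ → Fin d → ℂ) (w : ℝ) :
    ((‖rowMul M g w‖ ^ 2 : ℝ) : ℂ) = g w ⬝ᵥ (M w * (M w)ᴴ) *ᵥ star (g w) := by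
  rw [← inner_rowMul, inner_self_eq_norm_sq_to_K]
  simp

theorem mul_mul_conjTranspose_apply (A F : Matrix (Fin d) (Fin d) ℂ) (a b : Fin d) :
    (A * F * Aᴴ) a b = A a ⬝ᵥ F *ᵥ star (A b) := by
  rw [Matrix.mul_assoc, Matrix.mul_apply_eq_vecMul]
  simp only [Matrix.vecMul, dotProduct, Matrix.mulVec, Matrix.mul_apply]
  rfl

theorem trace_conj_eq_sum (G F : Matrix (Fin d) (Fin d) ℂ) :
    Matrix.trace (G * F * Gᴴ) = ∑ a, G a ⬝ᵥ F *ᵥ star (G a) := by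
  exact Finset.sum_congr rfl fun a _ => mul_mul_conjTranspose_apply G F a a

/-- Since f = M M^*, the trace of G f G^* is the sum of the squared norms of the rows of G M.
Convergence in L²(f) is thus convergence of each row in `RowSpace r`. -/
theorem IsFactor.specNormSq_eq (hM : IsFactor f M) {G : ℝ → Matrix (Fin d) (Fin d) ℂ}
    (hG : ∀ a b, AEMeasurable (fun w => G w a b) freqMeasure) :
    specNormSq f G = ∑ a, eLpNorm (rowMul M fun w => G w a) 2 freqMeasure ^ 2 := by
  have h2 : ∀ a, eLpNorm (rowMul M fun w => G w a) 2 freqMeasure ^ 2 =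
      ∫⁻ w in freq, ‖rowMul M (fun w => G w a) w‖ₑ ^ 2 := by
    intro a
    have := eLpNorm_nnreal_pow_eq_lintegral (f := rowMul M fun w => G w a) (μ := freqMeasure)
      (p := 2) two_ne_zero
    simpa using this
  simp only [h2]
  rw [← lintegral_finsetSum' _ fun a _ =>
    ((hM.aestronglyMeasurable_rowMul fun b => hG a b).enorm.pow_const 2), specNormSq]
  refine lintegral_congr_ae ?_
  filter_upwards [hM.eq] with w hw
  have : (Matrix.trace (G w * f w * (G w)ᴴ)).re =
      ∑ a, ‖rowMul M (fun w => G w a) w‖ ^ 2 := by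
    rw [trace_conj_eq_sum, hw]
    have h3 : ∀ a, G w a ⬝ᵥ (M w * (M w)ᴴ) *ᵥ star (G w a) =
      ((‖rowMul M (fun w => G w a) w‖ ^ 2 : ℝ) : ℂ) := fun a =>
      (norm_sq_rowMul (M := M) (fun w => G w a) w).symm
    simp only [h3, ← Complex.ofReal_sum, Complex.ofReal_re]
  rw [this, ENNReal.ofReal_sum_of_nonneg fun a _ => sq_nonneg _]
  refine Finset.sum_congr rfl fun a _ => ?_
  rw [ENNReal.ofReal_pow (norm_nonneg _), ofReal_norm]

end SpectralNorm

/-! ### The stochastic integral as an isometry. -/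

section Integral

variable {Ω : Type*} [MeasurableSpace Ω] {P : Measure Ω} {d r : ℕ}
  {f : ℝ → Matrix (Fin d) (Fin d) ℂ} {M : ℝ → Matrix (Fin d) (Fin r) ℂ}

/-- The isometry `J` of the row space into `L²` induces the random measure `Z`. -/
def IsFactor.Induces (hM : IsFactor f M) (J : RowSpace r →ₗᵢ[ℂ] Lp ℂ 2 P)
    (Z : VectorMeasure ℝ (L2Vec P d)) : Prop :=
  ∀ (A : Set ℝ) (hA : MeasurableSet A) (b : Fin d),
    J ((hM.memLp_single (memLp_indicator_one hA) b).toLp _) = comp b (Z A)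

/-- The random measure `Z` has the covariance structure given by the density `f`. -/
def HasCov (f : ℝ → Matrix (Fin d) (Fin d) ℂ) (Z : VectorMeasure ℝ (L2Vec P d)) : Prop :=
  ∀ A B : Set ℝ, MeasurableSet A → MeasurableSet B → ∀ a b : Fin d,
    crossCov (Z A) (Z B) a b = ∫ w in A ∩ B ∩ freq, f w a b

theorem IsFactor.inner_indicator (hM : IsFactor f M) {A B : Set ℝ} (hA : MeasurableSet A)
    (hB : MeasurableSet B) (a b : Fin d) :
    inner ℂ ((hM.memLp_single (memLp_indicator_one hB) b).toLp _)
      ((hM.memLp_single (memLp_indicator_one hA) a).toLp _) =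
      ∫ w in A ∩ B ∩ freq, f w a b := by
  rw [hM.inner_single (memLp_indicator_one hB) (memLp_indicator_one hA), ← Measure.restrict_restrict (hA.inter hB),
    ← integral_indicator (hA.inter hB)]
  congr 1
  funext w
  by_cases h1 : w ∈ A <;> by_cases h2 : w ∈ B <;> simp [h1, h2]

theorem IsFactor.exists_induces (hM : IsFactor f M) {Z : VectorMeasure ℝ (L2Vec P d)}
    (hZ : HasCov f Z) : ∃ J : RowSpace r →ₗᵢ[ℂ] Lp ℂ 2 P, hM.Induces J Z := by
  obtain ⟨J, hJ⟩ := exists_linearIsometry_of_inner_eq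
    (fun p : {A : Set ℝ // MeasurableSet A} × Fin d =>
      (hM.memLp_single (memLp_indicator_one p.1.2) p.2).toLp _)
    (fun p => comp p.2 (Z p.1)) (fun p q => by
      rw [hM.inner_indicator q.1.2 p.1.2, ← crossCov_apply, hZ _ _ q.1.2 p.1.2]) hM.total_indicator
  exact ⟨J, fun A hA b => hJ (⟨A, hA⟩, b)⟩

/-- Rows of simple matrix functions. -/
def simpleRow (S : SimpleFunc ℝ (Matrix (Fin d) (Fin d) ℂ)) (a : Fin d) :
    SimpleFunc ℝ (Fin d → ℂ) :=
  S.map fun A => A a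

theorem IsFactor.comp_simpleIntegral (hM : IsFactor f M) {J : RowSpace r →ₗᵢ[ℂ] Lp ℂ 2 P}
    {Z : VectorMeasure ℝ (L2Vec P d)} (hJ : hM.Induces J Z)
    (S : SimpleFunc ℝ (Matrix (Fin d) (Fin d) ℂ)) (a : Fin d) :
    comp a (simpleIntegral Z S) = J ((hM.memLp_simple (simpleRow S a)).toLp _) := by
  have hlin : comp a (simpleIntegral Z S) = J (∑ A ∈ S.range, ∑ b, A a b •
      (hM.memLp_single (memLp_indicator_one (S.measurableSet_fiber A)) b).toLp _) := by
    simp only [simpleIntegral, map_sum, comp_matAct, map_smul, hJ _ (S.measurableSet_fiber _)]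
  rw [hlin]
  congr 1
  refine Lp.ext ?_
  refine EventuallyEq.trans ?_ (MemLp.coeFn_toLp _).symm
  refine (Lp.coeFn_fun_finsetSum _ _).trans ?_
  have h1 : ∀ᵐ w ∂freqMeasure, ∀ A : S.range, ∀ b : Fin d,
      ((hM.memLp_single (memLp_indicator_one (S.measurableSet_fiber A.1)) b).toLp _ :
        RowSpace r) w = rowMul M (fun w => Pi.single b ((S ⁻¹' {A.1}).indicator 1 w)) w := by
    rw [ae_all_iff]
    intro A
    rw [ae_all_iff]
    intro b
    exact MemLp.coeFn_toLp _
  have h2 : ∀ᵐ w ∂freqMeasure, ∀ A : S.range, ∀ b : Fin d,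
      (A.1 a b • ((hM.memLp_single (memLp_indicator_one (S.measurableSet_fiber A.1)) b).toLp _ :
        RowSpace r)) w = A.1 a b •
        ((hM.memLp_single (memLp_indicator_one (S.measurableSet_fiber A.1)) b).toLp _ :
          RowSpace r) w := by
    rw [ae_all_iff]
    intro A
    rw [ae_all_iff]
    intro b
    exact Lp.coeFn_smul _ _
  have h3 : ∀ᵐ w ∂freqMeasure, ∀ A : S.range,
      (∑ b, A.1 a b •
        ((hM.memLp_single (memLp_indicator_one (S.measurableSet_fiber A.1)) b).toLp _ :
          RowSpace r)) w = ∑ b, (A.1 a b •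
        ((hM.memLp_single (memLp_indicator_one (S.measurableSet_fiber A.1)) b).toLp _ :
          RowSpace r)) w := by
    rw [ae_all_iff]
    intro A
    exact Lp.coeFn_fun_finsetSum _ _
  filter_upwards [h1, h2, h3] with w h1 h2 h3
  -- At a given frequency only the fibre of the value `S w` contributes.
  rw [Finset.sum_eq_single_of_mem (S w) (S.mem_range_self w)]
  · rw [h3 ⟨S w, S.mem_range_self w⟩]
    simp only [h2 ⟨S w, S.mem_range_self w⟩, h1 ⟨S w, S.mem_range_self w⟩]
    ext j
    simp [rowMul, simpleRow, Matrix.vecMul, dotProduct]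
  · intro A hA hne
    rw [h3 ⟨A, hA⟩]
    refine Finset.sum_eq_zero fun b _ => ?_
    rw [h2 ⟨A, hA⟩, h1 ⟨A, hA⟩]
    simp [rowMul, hne.symm]

/-- The simple matrix function with given rows. -/
def ofSimpleRows (s : Fin d → SimpleFunc ℝ (Fin d → ℂ)) :
    SimpleFunc ℝ (Matrix (Fin d) (Fin d) ℂ) where
  toFun w := Matrix.of fun a => s a w
  measurableSet_fiber' A := by
    have : (fun w => Matrix.of fun a => s a w) ⁻¹' {A} = ⋂ a, s a ⁻¹' {A a} := by
      ext w
      simp only [Set.mem_preimage, Set.mem_singleton_iff, Set.mem_iInter]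
      exact funext_iff
    rw [this]
    exact MeasurableSet.iInter fun a => (s a).measurableSet_fiber _
  finite_range' := by
    refine (Set.Finite.pi' fun a => (s a).finite_range).subset ?_
    rintro _ ⟨w, rfl⟩ a
    exact ⟨w, rfl⟩

theorem simpleRow_ofSimpleRows (s : Fin d → SimpleFunc ℝ (Fin d → ℂ)) (a : Fin d) :
    simpleRow (ofSimpleRows s) a = s a := rfl

/-- The stochastic integral is computed by the isometry of the row space. -/
theorem IsFactor.hasSpectralIntegral_iff (hM : IsFactor f M)
    {J : RowSpace r →ₗᵢ[ℂ] Lp ℂ 2 P} {Z : VectorMeasure ℝ (L2Vec P d)} (hJ : hM.Induces J Z)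
    {G : ℝ → Matrix (Fin d) (Fin d) ℂ} {V : L2Vec P d} :
    HasSpectralIntegral f Z G V ↔ (∀ a b, AEMeasurable (fun w => G w a b) freqMeasure) ∧
      ∀ a, ∃ h : MemLp (rowMul M fun w => G w a) 2 freqMeasure, comp a V = J (h.toLp _) := by
  have hmeas : (∀ a b, AEMeasurable (fun w => G w a b) freqMeasure) →
      ∀ S : SimpleFunc ℝ (Matrix (Fin d) (Fin d) ℂ),
      ∀ a b, AEMeasurable (fun w => (G w - S w) a b) freqMeasure := fun hG S a b =>
    (hG a b).sub (SimpleFunc.measurable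
      (S.map fun A : Matrix (Fin d) (Fin d) ℂ => A a b)).aemeasurable
  have hrow : ∀ (S : SimpleFunc ℝ (Matrix (Fin d) (Fin d) ℂ)) (a : Fin d),
      (rowMul M fun w => (G w - S w) a) = (rowMul M fun w => G w a) - rowMul M (simpleRow S a) :=
    fun S a => rowMul_sub _ _
  constructor
  · rintro ⟨hG, S, hS, hV⟩
    refine ⟨hG, fun a => ?_⟩
    have hlim : Tendsto (fun n => eLpNorm (rowMul M fun w => (G w - S n w) a) 2 freqMeasure ^ 2)
        atTop (𝓝 0) := by
      refine tendsto_of_tendsto_of_tendsto_of_le_of_le tendsto_const_nhds hS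
        (fun _ => zero_le) fun n => ?_
      simp only [hM.specNormSq_eq (hmeas hG (S n))]
      exact Finset.single_le_sum
        (f := fun a => eLpNorm (rowMul M fun w => (G w - S n w) a) 2 freqMeasure ^ 2)
        (fun _ _ => zero_le) (Finset.mem_univ a)
    have hlim' : Tendsto (fun n => eLpNorm (rowMul M fun w => (G w - S n w) a) 2 freqMeasure)
        atTop (𝓝 0) := by
      have := (ENNReal.continuous_rpow_const (y := 1 / 2)).tendsto 0 |>.comp hlim
      simp only [Function.comp_def, ← ENNReal.rpow_natCast, ← ENNReal.rpow_mul] at this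
      simpa using this
    obtain ⟨n, hn⟩ := (hlim'.eventually (gt_mem_nhds ENNReal.zero_lt_top)).exists
    have hGa : MemLp (rowMul M fun w => G w a) 2 freqMeasure := by
      -- One approximant at finite distance suffices: row a of `G` is this difference plus a simple
      -- row, which is square integrable after multiplication by M.
      have h1 : MemLp (rowMul M fun w => (G w - S n w) a) 2 freqMeasure :=
        ⟨hM.aestronglyMeasurable_rowMul (hmeas hG (S n) a), hn⟩
      have h2 := h1.add (hM.memLp_simple (simpleRow (S n) a))
      rwa [hrow, sub_add_cancel] at h2
    refine ⟨hGa, ?_⟩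
    have hc : Tendsto (fun n => (hM.memLp_simple (simpleRow (S n) a)).toLp _) atTop
        (𝓝 (hGa.toLp _)) := by
      rw [Lp.tendsto_Lp_iff_tendsto_eLpNorm'']
      refine hlim'.congr fun n => ?_
      rw [hrow, eLpNorm_sub_comm]
    refine tendsto_nhds_unique (tendsto_comp_iff.1 hV a) ?_
    simp only [hM.comp_simpleIntegral hJ]
    exact (J.continuous.tendsto _).comp hc
  · rintro ⟨hG, hV⟩
    choose hGa hVa using hV
    have hex : ∀ (n : ℕ) (a : Fin d), ∃ s : SimpleFunc ℝ (Fin d → ℂ),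
        ‖(hM.memLp_simple s).toLp _ - (hGa a).toLp _‖ < 1 / ((n : ℝ) + 1) := fun n a =>
      hM.exists_simple_norm_sub_lt _ Nat.one_div_pos_of_nat
    choose s hs using hex
    have hc : ∀ a, Tendsto (fun n => (hM.memLp_simple (s n a)).toLp _) atTop
        (𝓝 ((hGa a).toLp _)) := fun a => by
      rw [tendsto_iff_norm_sub_tendsto_zero]
      exact squeeze_zero (fun _ => norm_nonneg _) (fun n => (hs n a).le)
        tendsto_one_div_add_atTop_nhds_zero_nat
    refine ⟨hG, fun n => ofSimpleRows (s n), ?_, ?_⟩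
    · simp only [hM.specNormSq_eq (hmeas hG _)]
      have : Tendsto (fun n => ∑ a, eLpNorm (rowMul M fun w => (G w - ofSimpleRows (s n) w) a) 2
          freqMeasure ^ 2) atTop (𝓝 (∑ _a : Fin d, 0 ^ 2)) := by
        refine tendsto_finsetSum _ fun a _ => ENNReal.Tendsto.pow ?_
        have h1 := (Lp.tendsto_Lp_iff_tendsto_eLpNorm'' _ _ _ _).1 (hc a)
        refine h1.congr fun n => ?_
        rw [hrow, simpleRow_ofSimpleRows, eLpNorm_sub_comm]
      simpa using this
    · rw [tendsto_comp_iff]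
      intro a
      simp only [hM.comp_simpleIntegral hJ, hVa, simpleRow_ofSimpleRows]
      exact (J.continuous.tendsto _).comp (hc a)

end Integral

/-! ### Construction of the random measure from an isometry. -/

section Existence

/-- An orthogonal family sums to `x`, if its terms are projections of `x` and its energy is that
of `x`. -/
theorem hasSum_of_inner_eq {H : Type*} [NormedAddCommGroup H] [InnerProductSpace ℂ H]
    {ι : Type*} {v : ι → H} {x : H} (ho : ∀ i j, i ≠ j → inner ℂ (v i) (v j) = 0)
    (hx : ∀ i, inner ℂ (v i) x = inner ℂ (v i) (v i))
    (hs : HasSum (fun i => inner ℂ (v i) (v i)) (inner ℂ x x)) : HasSum v x := by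
  -- Pythagoras: the residual x - ∑ v_i is orthogonal to each v_i with i in `s`.
  have key : ∀ s : Finset ι, ((‖∑ i ∈ s, v i - x‖ ^ 2 : ℝ) : ℂ) =
      inner ℂ x x - ∑ i ∈ s, inner ℂ (v i) (v i) := by
    intro s
    have h0 : ∀ i ∈ s, inner ℂ (v i) (x - ∑ j ∈ s, v j) = 0 := by
      intro i hi
      rw [inner_sub_right, inner_sum, Finset.sum_eq_single_of_mem i hi fun j _ hj => ho i j hj.symm,
        hx, sub_self]
    have h1 : inner ℂ (x - ∑ j ∈ s, v j) (x - ∑ j ∈ s, v j) = inner ℂ x (x - ∑ j ∈ s, v j) := by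
      rw [inner_sub_left (x := x), sum_inner, Finset.sum_eq_zero h0, sub_zero]
    rw [norm_sub_rev]
    have h2 := inner_self_eq_norm_sq_to_K (𝕜 := ℂ) (x - ∑ j ∈ s, v j)
    rw [h1, inner_sub_right, inner_sum] at h2
    push_cast
    refine h2.symm.trans ?_
    congr 1
    refine Finset.sum_congr rfl fun i _ => ?_
    rw [← inner_conj_symm, hx, inner_conj_symm]
  have hlim : Tendsto (fun s : Finset ι => ((‖∑ i ∈ s, v i - x‖ ^ 2 : ℝ) : ℂ)) atTop (𝓝 0) := by
    simp only [key]
    have := (tendsto_const_nhds (x := inner ℂ x x)).sub hs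
    simpa using this
  have hlim' : Tendsto (fun s : Finset ι => ‖∑ i ∈ s, v i - x‖ ^ 2) atTop (𝓝 0) := by
    have := (Complex.continuous_re.tendsto 0).comp hlim
    simpa only [Function.comp_def, Complex.ofReal_re, Complex.zero_re] using this
  have h3 : Tendsto (fun s : Finset ι => ‖∑ i ∈ s, v i - x‖) atTop (𝓝 0) := by
    have := hlim'.sqrt
    simpa [Real.sqrt_sq (norm_nonneg _)] using this
  exact tendsto_iff_norm_sub_tendsto_zero.2 h3

variable {Ω : Type*} [MeasurableSpace Ω] {P : Measure Ω} {d r : ℕ}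
  {f : ℝ → Matrix (Fin d) (Fin d) ℂ} {M : ℝ → Matrix (Fin d) (Fin r) ℂ}

theorem IsFactor.integrableOn (hM : IsFactor f M) (a b : Fin d) :
    IntegrableOn (fun w => f w a b) freq := by
  have h1 : MemLp (1 : ℝ → ℂ) ∞ freqMeasure := MemLp.of_bound aestronglyMeasurable_one 1 (by simp)
  refine (hM.integrable_form (hM.memLp_single h1 b) (hM.memLp_single h1 a)).congr
    (ae_of_all _ fun w => ?_)
  simp only
  rw [single_dotProduct, ← Pi.single_star, Matrix.mulVec_single]
  simp

open Classical in
/-- The random measure induced by an isometry of the row space. -/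
noncomputable def IsFactor.randomMeasure (hM : IsFactor f M)
    (J : RowSpace r →ₗᵢ[ℂ] Lp ℂ 2 P) : VectorMeasure ℝ (L2Vec P d) where
  measureOf' A := if hA : MeasurableSet A then
    ofComp fun b => J ((hM.memLp_single (memLp_indicator_one hA) b).toLp _) else 0
  empty' := by
    rw [dif_pos MeasurableSet.empty]
    refine ext_comp fun b => ?_
    rw [comp_ofComp, map_zero]
    convert J.map_zero
    refine (Lp.eq_zero_iff_ae_eq_zero).2 ((MemLp.coeFn_toLp _).trans (ae_of_all _ fun w => ?_))
    simp [rowMul]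
  not_measurable' A hA := dif_neg hA
  m_iUnion' A hA hdisj := by
    have hU := MeasurableSet.iUnion hA
    simp only [hA, hU, dif_pos]
    refine hasSum_sum fun b _ => ?_
    refine HasSum.mapL (ContinuousLinearMap.compLpL 2 P _) (HasSum.mapL J.toContinuousLinearMap ?_)
    -- Disjoint sets give orthogonal rows, intersecting the union with one piece returns the piece,
    -- and the energies add up by countable additivity of ∫ f_bb.
    refine hasSum_of_inner_eq ?_ ?_ ?_
    · intro i j hij
      rw [hM.inner_indicator (hA j) (hA i), (hdisj hij.symm).inter_eq]
      simp
    · intro i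
      rw [hM.inner_indicator hU (hA i), hM.inner_indicator (hA i) (hA i),
        Set.inter_eq_right.2 (Set.subset_iUnion A i), Set.inter_self]
    · simp only [hM.inner_indicator (hA _) (hA _), hM.inner_indicator hU hU, Set.inter_self]
      simp only [← Measure.restrict_restrict (hA _), ← Measure.restrict_restrict hU]
      exact hasSum_integral_iUnion hA hdisj (hM.integrableOn b b).integrableOn

theorem IsFactor.induces_randomMeasure (hM : IsFactor f M) (J : RowSpace r →ₗᵢ[ℂ] Lp ℂ 2 P) :
    hM.Induces J (hM.randomMeasure J) := by
  intro A hA b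
  have : hM.randomMeasure J A =
      ofComp fun b => J ((hM.memLp_single (memLp_indicator_one hA) b).toLp _) := dif_pos hA
  rw [this, comp_ofComp]

theorem IsFactor.Induces.hasCov {hM : IsFactor f M} {J : RowSpace r →ₗᵢ[ℂ] Lp ℂ 2 P}
    {Z : VectorMeasure ℝ (L2Vec P d)} (hJ : hM.Induces J Z) : HasCov f Z := by
  intro A B hA hB a b
  rw [crossCov_apply, ← hJ A hA, ← hJ B hB, LinearIsometry.inner_map_map,
    hM.inner_indicator hA hB]

end Existence

/-! ### Filtered processes: existence, spectral density, rank and norm. -/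

section Filters

variable {Ω : Type*} [MeasurableSpace Ω] {P : Measure Ω} {d r : ℕ}
  {f : ℝ → Matrix (Fin d) (Fin d) ℂ} {M : ℝ → Matrix (Fin d) (Fin r) ℂ}
  {hM : IsFactor f M} {J : RowSpace r →ₗᵢ[ℂ] Lp ℂ 2 P} {Z : VectorMeasure ℝ (L2Vec P d)}
  {T : ℝ → Matrix (Fin d) (Fin d) ℂ} {Y : ℤ → L2Vec P d}

/-- The transfer function `e^{itω} T(ω)`. -/
noncomputable def modulate (T : ℝ → Matrix (Fin d) (Fin d) ℂ) (t : ℤ) :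
    ℝ → Matrix (Fin d) (Fin d) ℂ :=
  fun w => Complex.exp (Complex.I * (t : ℂ) * (w : ℂ)) • T w

theorem aemeasurable_modulate (hT : ∀ a b, AEMeasurable (fun w => T w a b) freqMeasure) (t : ℤ)
    (a b : Fin d) : AEMeasurable (fun w => modulate T t w a b) freqMeasure :=
  (memLp_exp t).aestronglyMeasurable.aemeasurable.mul (hT a b)

theorem rowMul_modulate_apply (t : ℤ) (a : Fin d) (w : ℝ) (j : Fin r) :
    rowMul M (fun w => modulate T t w a) w j =
      Complex.exp (Complex.I * (t : ℂ) * (w : ℂ)) * (T w * M w) a j := by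
  have : modulate T t w a = Complex.exp (Complex.I * (t : ℂ) * (w : ℂ)) • T w a := rfl
  simp only [rowMul, this, Matrix.smul_vecMul, Pi.smul_apply, smul_eq_mul,
    Matrix.mul_apply_eq_vecMul]

theorem modulate_form (s t : ℤ) (a b : Fin d) (w : ℝ) :
    modulate T s w a ⬝ᵥ f w *ᵥ star (modulate T t w b) =
      Complex.exp (Complex.I * ((s - t : ℤ) : ℂ) * (w : ℂ)) * (T w * f w * (T w)ᴴ) a b := by
  have h : ∀ (t : ℤ) a, modulate T t w a =
    Complex.exp (Complex.I * (t : ℂ) * (w : ℂ)) • T w a := fun _ _ => rfl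
  rw [h, h, star_smul, Matrix.mulVec_smul, smul_dotProduct, dotProduct_smul,
    mul_mul_conjTranspose_apply, ← exp_mul_star_exp, smul_smul, smul_eq_mul]

theorem IsFactor.Induces.isFiltered_iff (hJ : hM.Induces J Z) :
    IsFiltered f Z T Y ↔ (∀ a b, AEMeasurable (fun w => T w a b) freqMeasure) ∧
      ∀ t a, ∃ h : MemLp (rowMul M fun w => modulate T t w a) 2 freqMeasure,
        comp a (Y t) = J (h.toLp _) := by
  constructor
  · intro h
    refine ⟨fun a b => ?_, fun t => ((hM.hasSpectralIntegral_iff hJ).1 (h t)).2⟩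
    -- At time 0 the exponential factor is 1, so measurability of `T` itself can be read off.
    simpa using (h 0).1 a b
  · rintro ⟨h1, h2⟩ t
    exact (hM.hasSpectralIntegral_iff hJ).2 ⟨aemeasurable_modulate h1 t, h2 t⟩

theorem memLp_rowMul_modulate (hT : ∀ a j, MemLp (fun w => (T w * M w) a j) 2 freqMeasure)
    (t : ℤ) (a : Fin d) : MemLp (rowMul M fun w => modulate T t w a) 2 freqMeasure := by
  refine MemLp.of_eval_piLp fun j => ?_
  simp only [rowMul_modulate_apply]
  exact MemLp.mul (p := ∞) (q := 2) (hT a j) (memLp_exp t)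

theorem IsFactor.Induces.existsUnique_isFiltered (hJ : hM.Induces J Z)
    (hT : ∀ a b, AEMeasurable (fun w => T w a b) freqMeasure)
    (hTM : ∀ a j, MemLp (fun w => (T w * M w) a j) 2 freqMeasure) :
    ∃! Y, IsFiltered f Z T Y := by
  refine ⟨fun t => ofComp fun a => J ((memLp_rowMul_modulate hTM t a).toLp _), ?_, ?_⟩
  · exact hJ.isFiltered_iff.2 ⟨hT, fun t a => ⟨memLp_rowMul_modulate hTM t a, comp_ofComp _ _⟩⟩
  · intro Y hY
    funext t
    refine ext_comp fun a => ?_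
    obtain ⟨_, h⟩ := (hJ.isFiltered_iff.1 hY).2 t a
    rw [h, comp_ofComp]

theorem IsFactor.Induces.isFiltered_sub (hJ : hM.Induces J Z) (hY : IsFiltered f Z T Y)
    {T' : ℝ → Matrix (Fin d) (Fin d) ℂ} {Y' : ℤ → L2Vec P d} (hY' : IsFiltered f Z T' Y') :
    IsFiltered f Z (fun w => T w - T' w) (fun t => Y t - Y' t) := by
  rw [hJ.isFiltered_iff] at hY hY' ⊢
  refine ⟨fun a b => (hY.1 a b).sub (hY'.1 a b), fun t a => ?_⟩
  obtain ⟨h, e⟩ := hY.2 t a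
  obtain ⟨h', e'⟩ := hY'.2 t a
  have hsub : (rowMul M fun w => modulate (fun w => T w - T' w) t w a) =
      (rowMul M fun w => modulate T t w a) - rowMul M fun w => modulate T' t w a := by
    rw [← rowMul_sub]
    congr 1
    funext w b
    simp [modulate, mul_sub]
  have hm := h.sub h'
  rw [← hsub] at hm
  refine ⟨hm, ?_⟩
  rw [map_sub, e, e', ← map_sub, ← MemLp.toLp_sub]
  congr 1
  exact MemLp.toLp_congr _ _ (by rw [hsub])

/-- J preserves inner products, and the modulations at two times combine into the exponential of
their lag. -/
theorem IsFactor.Induces.isSpectralDensity (hJ : hM.Induces J Z) (hY : IsFiltered f Z T Y) :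
    IsSpectralDensity Y fun w => T w * f w * (T w)ᴴ := by
  have hY2 := (hJ.isFiltered_iff.1 hY).2
  refine ⟨fun a b => ?_, ?_, fun t h a b => ?_⟩
  · obtain ⟨ha, _⟩ := hY2 0 a
    obtain ⟨hb, _⟩ := hY2 0 b
    have := hM.integrable_form hb ha
    simp only [modulate_form] at this
    simpa using this
  · filter_upwards [hM.eq] with w hw
    rw [hw, show T w * (M w * (M w)ᴴ) * (T w)ᴴ = (T w * M w) * (T w * M w)ᴴ by
      simp only [Matrix.conjTranspose_mul, Matrix.mul_assoc]]
    exact Matrix.posSemidef_self_mul_conjTranspose _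
  · obtain ⟨ha, ea⟩ := hY2 (t + h) a
    obtain ⟨hb, eb⟩ := hY2 t b
    rw [crossCov_apply, ea, eb, LinearIsometry.inner_map_map, hM.inner_toLp]
    simp only [modulate_form, add_sub_cancel_left]

/-- This converts a rank bound on the density of a filtered process into one on T M, the matrix to
which Eckart–Young is applied. -/
theorem IsFactor.rank_filtered_eq (hM : IsFactor f M) (T : ℝ → Matrix (Fin d) (Fin d) ℂ) :
    ∀ᵐ w ∂freqMeasure, (T w * f w * (T w)ᴴ).rank = (T w * M w).rank := by
  filter_upwards [hM.eq] with w hw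
  rw [hw, show T w * (M w * (M w)ᴴ) * (T w)ᴴ = (T w * M w) * (T w * M w)ᴴ by
      simp only [Matrix.conjTranspose_mul, Matrix.mul_assoc], Matrix.rank_self_mul_conjTranspose]

/-- The modulation has modulus 1, so the time drops out and mean square errors become integrals of
Frobenius norms. -/
theorem IsFactor.Induces.norm_sq_filtered (hJ : hM.Induces J Z) (hY : IsFiltered f Z T Y) (t : ℤ) :
    IntegrableOn (fun w => ∑ a, ∑ j, ‖(T w * M w) a j‖ ^ 2) freq ∧
      ‖Y t‖ ^ 2 = ∫ w in freq, ∑ a, ∑ j, ‖(T w * M w) a j‖ ^ 2 := by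
  have hY2 := (hJ.isFiltered_iff.1 hY).2 t
  choose hm hc using hY2
  have hn : ∀ a w, ‖rowMul M (fun w => modulate T t w a) w‖ ^ 2 =
      ∑ j, ‖(T w * M w) a j‖ ^ 2 := by
    intro a w
    rw [EuclideanSpace.norm_sq_eq]
    refine Finset.sum_congr rfl fun j _ => ?_
    rw [rowMul_modulate_apply, norm_mul, Complex.norm_exp]
    simp
  have hi : ∀ a, IntegrableOn (fun w => ∑ j, ‖(T w * M w) a j‖ ^ 2) freq := by
    intro a
    exact ((memLp_two_iff_integrable_sq_norm (hm a).1).1 (hm a)).congr (ae_of_all _ (hn a))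
  refine ⟨integrable_finsetSum _ fun a _ => hi a, ?_⟩
  rw [integral_finsetSum _ fun a _ => hi a, norm_sq_eq_sum_comp]
  refine Finset.sum_congr rfl fun a _ => ?_
  rw [hc, LinearIsometry.norm_map]
  have h1 := inner_self_eq_norm_sq_to_K (𝕜 := ℂ) ((hm a).toLp _)
  rw [L2.inner_def] at h1
  have h2 : ∫ w in freq, inner ℂ (((hm a).toLp _ : RowSpace r) w) (((hm a).toLp _ : RowSpace r) w) =
      ∫ w in freq, ((∑ j, ‖(T w * M w) a j‖ ^ 2 : ℝ) : ℂ) := by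
    refine integral_congr_ae ?_
    filter_upwards [(hm a).coeFn_toLp] with w hw
    rw [hw, inner_self_eq_norm_sq_to_K, ← hn]
    simp
  have h3 := integral_complex_ofReal.symm.trans (h2.symm.trans h1)
  apply Complex.ofReal_injective
  rw [Complex.ofReal_pow]
  exact h3.symm

/-- A spectral density is determined a.e. by the covariances. -/
theorem IsSpectralDensity.ae_eq {Y : ℤ → L2Vec P d} {g g' : ℝ → Matrix (Fin d) (Fin d) ℂ}
    (hg : IsSpectralDensity Y g) (hg' : IsSpectralDensity Y g') :
    ∀ᵐ w ∂freqMeasure, g w = g' w := by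
  have : ∀ᵐ w ∂freqMeasure, ∀ a b, g w a b - g' w a b = 0 := by
    refine ae_all_iff.2 fun a => ae_all_iff.2 fun b => ?_
    refine ae_eq_zero_of_fourier_eq_zero ((hg.integrable a b).sub (hg'.integrable a b)) fun t => ?_
    have hint : ∀ {h : ℝ → ℂ}, IntegrableOn h freq → IntegrableOn
        (fun w : ℝ => Complex.exp (Complex.I * (t : ℂ) * (w : ℂ)) * h w) freq := fun hh =>
      hh.bdd_mul (c := 1) (Continuous.aestronglyMeasurable (by fun_prop)) (ae_of_all _ fun w => by
        rw [Complex.norm_exp]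
        simp)
    simp only [mul_sub]
    rw [integral_sub (hint (hg.integrable a b)) (hint (hg'.integrable a b)), ← hg.cov_eq 0,
      ← hg'.cov_eq 0, sub_self]
  filter_upwards [this] with w hw
  ext a b
  exact sub_eq_zero.1 (hw a b)

theorem IsSpectralDensity.isStationary {Y : ℤ → L2Vec P d} {g : ℝ → Matrix (Fin d) (Fin d) ℂ}
    (hg : IsSpectralDensity Y g) (h0 : ∀ t, ∫ x, Y t x ∂P = 0) : IsStationary Y := by
  refine ⟨h0, fun s t h => ?_⟩
  ext a b
  rw [hg.cov_eq, hg.cov_eq]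

end Filters

/-! ### Cramér's representation and zero means. -/

section Cramer

variable {Ω : Type*} [MeasurableSpace Ω] {P : Measure Ω} {d r : ℕ}
  {f : ℝ → Matrix (Fin d) (Fin d) ℂ} {M : ℝ → Matrix (Fin d) (Fin r) ℂ} {X : ℤ → L2Vec P d}

theorem modulate_one_row (t : ℤ) (a : Fin d) :
    (fun w => modulate (fun _ => (1 : Matrix (Fin d) (Fin d) ℂ)) t w a) =
      fun w : ℝ => Pi.single a (Complex.exp (Complex.I * (t : ℂ) * (w : ℂ))) := by
  funext w b
  rcases eq_or_ne a b with rfl | hb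
  · simp [modulate]
  · simp [modulate, hb, hb.symm]

theorem IsFactor.Induces.represents_iff {hM : IsFactor f M} {J : RowSpace r →ₗᵢ[ℂ] Lp ℂ 2 P}
    {Z : VectorMeasure ℝ (L2Vec P d)} (hJ : hM.Induces J Z) :
    IsFiltered f Z (fun _ => 1) X ↔
      ∀ t a, J ((hM.memLp_single (memLp_exp t) a).toLp _) = comp a (X t) := by
  rw [hJ.isFiltered_iff]
  simp only [modulate_one_row]
  constructor
  · rintro ⟨_, h⟩ t a
    obtain ⟨_, e⟩ := h t a
    exact e.symm
  · exact fun h => ⟨fun a b => aemeasurable_const, fun t a => ⟨hM.memLp_single (memLp_exp t) a, (h t a).symm⟩⟩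

/-- **Cramér's representation**. -/
theorem IsFactor.existsUnique_cramer (hM : IsFactor f M) (hf : IsSpectralDensity X f) :
    ∃! Z, IsCramerMeasure X f Z := by
  obtain ⟨J, hJ⟩ := exists_linearIsometry_of_inner_eq
    (fun p : ℤ × Fin d => (hM.memLp_single (memLp_exp p.1) p.2).toLp _)
    (fun p => comp p.2 (X p.1)) (fun p q => by
      rw [hM.inner_single (memLp_exp p.1) (memLp_exp q.1), ← crossCov_apply]
      simp only [exp_mul_star_exp]
      rw [← hf.cov_eq p.1, add_sub_cancel]) hM.total_exp
  refine ⟨hM.randomMeasure J, ⟨(hM.induces_randomMeasure J).hasCov,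
    (hM.induces_randomMeasure J).represents_iff.2 fun t a => hJ (t, a)⟩, ?_⟩
  intro Z hZ
  obtain ⟨J', hJ'⟩ := hM.exists_induces hZ.cov_eq
  -- Any other representing measure induces an isometry with the same values X_t on the
  -- exponentials; equal isometries then agree on indicators.
  have hJJ : J' = J := eq_of_eq_on_total hM.total_exp fun p => by
    rw [hJ p, ← hJ'.represents_iff.1 hZ.represents]
  subst hJJ
  refine VectorMeasure.ext fun A hA => ext_comp fun b => ?_
  rw [← hJ' A hA b, hM.induces_randomMeasure J' A hA b]

theorem integral_eq_zero_iff_comp [IsFiniteMeasure P] (V : L2Vec P d) :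
    ∫ x, V x ∂P = 0 ↔ ∀ a, ∫ x, comp a V x ∂P = 0 := by
  have hi : ∀ a, Integrable (fun x => V x a) P := fun a =>
    ((Lp.memLp V).eval_piLp a).integrable one_le_two
  have h : ∀ a, ∫ x, comp a V x ∂P = (∫ x, V x ∂P) a := fun a => by
    rw [eval_integral_piLp hi]
    exact integral_congr_ae (coeFn_comp a V)
  simp only [h]
  exact ⟨fun h a => by rw [h]; rfl, fun h => by ext a; exact h a⟩

theorem IsFactor.Induces.integral_filtered_eq_zero [IsFiniteMeasure P] {hM : IsFactor f M}
    {J : RowSpace r →ₗᵢ[ℂ] Lp ℂ 2 P} {Z : VectorMeasure ℝ (L2Vec P d)} (hJ : hM.Induces J Z)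
    (hX : IsFiltered f Z (fun _ => 1) X) (h0 : ∀ t, ∫ x, X t x ∂P = 0)
    {T : ℝ → Matrix (Fin d) (Fin d) ℂ} {Y : ℤ → L2Vec P d} (hY : IsFiltered f Z T Y) (t : ℤ) :
    ∫ x, Y t x ∂P = 0 := by
  -- Expectation after J is the continuous functional h ↦ ⟨1, J h⟩. It vanishes on the exponentials
  -- because `X` has mean zero, hence everywhere.
  let Λ : RowSpace r →L[ℂ] ℂ := (innerSL ℂ (indicatorConstLp 2 MeasurableSet.univ
    (measure_ne_top P _) (1 : ℂ))).comp J.toContinuousLinearMap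
  have hΛ : ∀ h, Λ h = ∫ x, J h x ∂P := fun h => by
    have := L2.inner_indicatorConstLp_one (𝕜 := ℂ) MeasurableSet.univ (measure_ne_top P _) (J h)
    rw [setIntegral_univ] at this
    exact this
  have hzero : Λ = 0 := by
    refine ContinuousLinearMap.ext_on (s := Set.range fun p : ℤ × Fin d =>
      (hM.memLp_single (memLp_exp p.1) p.2).toLp _) ?_ ?_
    · rw [Submodule.dense_iff_topologicalClosure_eq_top, hM.total_exp]
    · rintro _ ⟨p, rfl⟩
      rw [hΛ, hJ.represents_iff.1 hX, (integral_eq_zero_iff_comp _).1 (h0 p.1)]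
      rfl
  rw [integral_eq_zero_iff_comp]
  intro a
  obtain ⟨_, e⟩ := (hJ.isFiltered_iff.1 hY).2 t a
  rw [e, ← hΛ, hzero]
  rfl

end Cramer

/-! ### The factor U diag(√λ) and the projection filter. -/

section Decomposition

variable {d r k : ℕ}

/-- Eigenvalues are numbered from 1 but columns from 0, so tail indices j ≥ k + 1 correspond to
columns ≥ k. -/
theorem sum_Icc_eq_sum_fin (k r : ℕ) (g : ℕ → ℝ) :
    ∑ j ∈ Finset.Icc (k + 1) r, g j = ∑ j : Fin r with k ≤ j.val, g (j.val + 1) := by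
  rw [Finset.sum_filter, Fin.sum_univ_eq_sum_range (fun i => if k ≤ i then g (i + 1) else 0) r,
    ← Finset.sum_filter]
  symm
  refine Finset.sum_bij (fun i _ => i + 1) ?_ ?_ ?_ fun _ _ => rfl
  · intro i hi
    simp only [Finset.mem_filter, Finset.mem_range, Finset.mem_Icc] at hi ⊢
    omega
  · intro i _ j _ h
    omega
  · intro j hj
    simp only [Finset.mem_Icc] at hj
    exact ⟨j - 1, by simp only [Finset.mem_filter, Finset.mem_range]; omega, by omega⟩

/-- The square root factor `U diag(√λ_1, …, √λ_r)`. -/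
noncomputable def sqrtFactor (lam : ℕ → ℝ → ℝ) (U : ℝ → Matrix (Fin d) (Fin r) ℂ) :
    ℝ → Matrix (Fin d) (Fin r) ℂ :=
  fun w => U w * Matrix.diagonal fun j : Fin r => ((Real.sqrt (lam (j.val + 1) w) : ℝ) : ℂ)

theorem sum_norm_sq_col {U : Matrix (Fin d) (Fin r) ℂ} (hU : Uᴴ * U = 1) (j : Fin r) :
    ∑ a, ‖U a j‖ ^ 2 = 1 := by
  have h := (orthonormal_cols hU).1 j
  have h2 := EuclideanSpace.norm_sq_eq (WithLp.toLp 2 fun a => U a j : EuclideanSpace ℂ (Fin d))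
  rw [h] at h2
  simpa using h2.symm

theorem firstCols_mul_self {U : Matrix (Fin d) (Fin r) ℂ} (hU : Uᴴ * U = 1) (hk : k ≤ r) :
    firstCols hk U * (firstCols hk U)ᴴ * U = Matrix.of fun a j => if j.val < k then U a j else 0 := by
  have h1 : (firstCols hk U)ᴴ * U = (1 : Matrix (Fin r) (Fin r) ℂ).submatrix (Fin.castLE hk) id := by
    rw [← hU]
    rfl
  rw [Matrix.mul_assoc, h1]
  ext a j
  simp only [Matrix.mul_apply, firstCols, Matrix.submatrix_apply, id, Matrix.of_apply,
    Matrix.one_apply, mul_ite, mul_one, mul_zero]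
  split_ifs with hj
  · rw [Finset.sum_eq_single (⟨j.val, hj⟩ : Fin k)]
    · simp
    · intro i _ hi
      rw [if_neg]
      rintro rfl
      exact hi rfl
    · simp
  · refine Finset.sum_eq_zero fun i _ => if_neg ?_
    rintro rfl
    exact hj i.2

theorem firstCols_orthonormal {U : Matrix (Fin d) (Fin r) ℂ} (hU : Uᴴ * U = 1) (hk : k ≤ r) :
    (firstCols hk U)ᴴ * firstCols hk U = 1 := by
  have : (firstCols hk U)ᴴ * firstCols hk U = (Uᴴ * U).submatrix (Fin.castLE hk) (Fin.castLE hk) :=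
    rfl
  rw [this, hU, Matrix.submatrix_one _ (Fin.castLE_injective hk)]

theorem rank_firstCols {U : Matrix (Fin d) (Fin r) ℂ} (hU : Uᴴ * U = 1) (hk : k ≤ r) :
    (firstCols hk U).rank = k := by
  rw [← Matrix.rank_conjTranspose_mul_self, firstCols_orthonormal hU, Matrix.rank_one,
    Fintype.card_fin]

variable {lam : ℕ → ℝ → ℝ} {U : ℝ → Matrix (Fin d) (Fin r) ℂ} {f : ℝ → Matrix (Fin d) (Fin d) ℂ}

theorem sqrtFactor_apply (w : ℝ) (a : Fin d) (j : Fin r) :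
    sqrtFactor lam U w a j = U w a j * ((Real.sqrt (lam (j.val + 1) w) : ℝ) : ℂ) := by
  rw [sqrtFactor, Matrix.mul_diagonal]

theorem IsSpectralDecomposition.pos_fin (h : IsSpectralDecomposition r f lam U) :
    ∀ᵐ w ∂freqMeasure, ∀ j : Fin r, 0 < lam (j.val + 1) w := by
  filter_upwards [h.pos] with w hw j
  exact hw _ (by omega) (by omega)

theorem IsSpectralDecomposition.sum_norm_sq_sqrtFactor (h : IsSpectralDecomposition r f lam U) :
    ∀ᵐ w ∂freqMeasure, ∀ j : Fin r, ∑ a, ‖sqrtFactor lam U w a j‖ ^ 2 = lam (j.val + 1) w := by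
  filter_upwards [h.pos_fin, h.orthonormal] with w h1 h2 j
  simp only [sqrtFactor_apply, norm_mul, mul_pow, Complex.norm_real, Real.norm_eq_abs, sq_abs,
    Real.sq_sqrt (h1 j).le]
  rw [← Finset.sum_mul, sum_norm_sq_col h2, one_mul]

theorem IsSpectralDecomposition.eq_mul_conjTranspose (h : IsSpectralDecomposition r f lam U) :
    ∀ᵐ w ∂freqMeasure, f w = sqrtFactor lam U w * (sqrtFactor lam U w)ᴴ := by
  filter_upwards [h.pos_fin, h.decomp] with w h1 h2
  rw [h2, sqrtFactor, Matrix.conjTranspose_mul, Matrix.diagonal_conjTranspose, Matrix.mul_assoc,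
    Matrix.mul_assoc, ← Matrix.mul_assoc (Matrix.diagonal _) (Matrix.diagonal _),
    Matrix.diagonal_mul_diagonal]
  congr 3
  funext j
  simp only [Pi.star_apply, Complex.star_def, Complex.conj_ofReal]
  rw [← Complex.ofReal_mul, Real.mul_self_sqrt (h1 j).le]

theorem IsSpectralDecomposition.isFactor (h : IsSpectralDecomposition r f lam U)
    (hf : ∀ a b, IntegrableOn (fun w => f w a b) freq) : IsFactor f (sqrtFactor lam U) := by
  -- The eigenvalues are not assumed measurable; they are recovered as the diagonal of U^* f U.
  have hlam : ∀ j : Fin r, AEMeasurable (fun w => lam (j.val + 1) w) freqMeasure := by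
    intro j
    have hm : AEMeasurable (fun w => (((U w)ᴴ * f w * U w) j j).re) freqMeasure := by
      simp only [Matrix.mul_apply, Matrix.conjTranspose_apply]
      refine Complex.measurable_re.comp_aemeasurable ?_
      refine Finset.aemeasurable_fun_sum _ fun b _ => AEMeasurable.mul ?_ (h.measurable b j)
      exact Finset.aemeasurable_fun_sum _ fun a _ =>
        (continuous_star.measurable.comp_aemeasurable (h.measurable a j)).mul
          (hf a b).aestronglyMeasurable.aemeasurable
    refine hm.congr ?_
    filter_upwards [h.orthonormal, h.decomp] with w h1 h2
    have : (U w)ᴴ * f w * U w =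
        Matrix.diagonal (fun i : Fin r => (lam (i.val + 1) w : ℂ)) := by
      rw [h2, Matrix.mul_assoc, Matrix.mul_assoc _ (U w)ᴴ, h1, Matrix.mul_one, ← Matrix.mul_assoc,
        h1, Matrix.one_mul]
    rw [this]
    simp
  refine ⟨fun a j => ?_, h.eq_mul_conjTranspose, ?_⟩
  · have hmeas : AEStronglyMeasurable (fun w => sqrtFactor lam U w a j) freqMeasure := by
      simp only [sqrtFactor_apply]
      exact ((h.measurable a j).mul (Complex.measurable_ofReal.comp_aemeasurable
        (Real.continuous_sqrt.measurable.comp_aemeasurable (hlam j)))).aestronglyMeasurable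
    rw [memLp_two_iff_integrable_sq_norm hmeas]
    -- The diagonal entry f_aa is the sum of |M_aj|² over j and so dominates each of them.
    refine Integrable.mono' (hf a a).norm (hmeas.norm.pow 2) ?_
    filter_upwards [h.eq_mul_conjTranspose] with w hw
    have : f w a a = ((∑ j, ‖sqrtFactor lam U w a j‖ ^ 2 : ℝ) : ℂ) := by
      rw [hw, Matrix.mul_apply]
      push_cast
      refine Finset.sum_congr rfl fun j _ => ?_
      rw [Matrix.conjTranspose_apply, Complex.star_def, Complex.mul_conj']
    rw [this, Complex.norm_real, Real.norm_eq_abs, Real.norm_eq_abs]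
    refine abs_le_abs_of_nonneg (sq_nonneg _) ?_
    exact Finset.single_le_sum (f := fun j => ‖sqrtFactor lam U w a j‖ ^ 2)
      (fun _ _ => sq_nonneg _) (Finset.mem_univ j)
  · filter_upwards [h.pos_fin, h.orthonormal] with w h1 h2 v hv
    have h3 : (U w)ᴴ *ᵥ (sqrtFactor lam U w *ᵥ v) = 0 := by rw [hv, Matrix.mulVec_zero]
    rw [Matrix.mulVec_mulVec, sqrtFactor, ← Matrix.mul_assoc, h2, Matrix.one_mul] at h3
    funext j
    have h4 := congrFun h3 j
    rw [Matrix.mulVec_diagonal] at h4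
    refine (mul_eq_zero.1 h4).resolve_left ?_
    exact_mod_cast (Real.sqrt_pos.2 (h1 j)).ne'

theorem IsSpectralDecomposition.integrable_lam (h : IsSpectralDecomposition r f lam U)
    (hf : ∀ a b, IntegrableOn (fun w => f w a b) freq) (k : ℕ) :
    IntegrableOn (fun w => ∑ j ∈ Finset.Icc (k + 1) r, lam j w) freq := by
  have hM := h.isFactor hf
  have hi : ∀ j : Fin r, IntegrableOn (fun w => lam (j.val + 1) w) freq := fun j => by
    have : IntegrableOn (fun w => ∑ a, ‖sqrtFactor lam U w a j‖ ^ 2) freq :=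
      integrable_finsetSum _ fun a _ =>
        (memLp_two_iff_integrable_sq_norm (hM.memLp a j).1).1 (hM.memLp a j)
    refine this.congr ?_
    filter_upwards [h.sum_norm_sq_sqrtFactor] with w hw
    exact hw j
  simp only [sum_Icc_eq_sum_fin k r fun j => lam j _]
  exact integrable_finsetSum _ fun j _ => hi j

theorem IsSpectralDecomposition.projFilter_mul (h : IsSpectralDecomposition r f lam U)
    (hk : k ≤ r) : ∀ᵐ w ∂freqMeasure, projFilter hk U w * sqrtFactor lam U w =
      Matrix.of fun a j => if j.val < k then sqrtFactor lam U w a j else 0 := by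
  filter_upwards [h.orthonormal] with w hw
  rw [projFilter, sqrtFactor, ← Matrix.mul_assoc, firstCols_mul_self hw]
  ext a j
  simp [Matrix.mul_diagonal]

theorem IsSpectralDecomposition.aemeasurable_projFilter (h : IsSpectralDecomposition r f lam U)
    (hk : k ≤ r) (a b : Fin d) :
    AEMeasurable (fun w => projFilter hk U w a b) freqMeasure := by
  simp only [projFilter, Matrix.mul_apply, Matrix.conjTranspose_apply, firstCols,
    Matrix.submatrix_apply, id]
  exact Finset.aemeasurable_fun_sum _ fun j _ => (h.measurable _ _).mul
    (continuous_star.measurable.comp_aemeasurable (h.measurable _ _))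

theorem IsSpectralDecomposition.memLp_projFilter_mul (h : IsSpectralDecomposition r f lam U)
    (hf : ∀ a b, IntegrableOn (fun w => f w a b) freq) (hk : k ≤ r) (a : Fin d) (j : Fin r) :
    MemLp (fun w => (projFilter hk U w * sqrtFactor lam U w) a j) 2 freqMeasure := by
  have hM := h.isFactor hf
  have : MemLp (fun w => if j.val < k then sqrtFactor lam U w a j else 0) 2 freqMeasure := by
    split_ifs
    · exact hM.memLp a j
    · exact MemLp.zero
  refine this.ae_eq ?_
  filter_upwards [h.projFilter_mul hk] with w hw
  rw [hw, Matrix.of_apply]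

theorem IsSpectralDecomposition.rank_projFilter_mul (h : IsSpectralDecomposition r f lam U)
    (hk : k ≤ r) : ∀ᵐ w ∂freqMeasure, (projFilter hk U w * sqrtFactor lam U w).rank = k := by
  filter_upwards [h.orthonormal, h.pos_fin] with w h1 h2
  have hunit : IsUnit (Matrix.diagonal
      fun j : Fin r => ((Real.sqrt (lam (j.val + 1) w) : ℝ) : ℂ)).det := by
    rw [Matrix.det_diagonal, isUnit_iff_ne_zero, Finset.prod_ne_zero_iff]
    intro j _
    exact_mod_cast (Real.sqrt_pos.2 (h2 j)).ne'
  rw [sqrtFactor, ← Matrix.mul_assoc, Matrix.rank_mul_eq_left_of_isUnit_det _ _ hunit]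
  refine le_antisymm ?_ ?_
  · refine (Matrix.rank_mul_le_left _ _).trans (le_of_eq ?_)
    rw [projFilter, Matrix.rank_self_mul_conjTranspose, rank_firstCols h1]
  -- Selecting the first k columns of U_k U_k^* U returns U_k, so the product cannot have smaller
  -- rank than U_k.
  · have h3 : projFilter hk U w * U w * (1 : Matrix (Fin r) (Fin r) ℂ).submatrix id (Fin.castLE hk) =
        firstCols hk (U w) := by
      have h4 : U w * (1 : Matrix (Fin r) (Fin r) ℂ).submatrix id (Fin.castLE hk) =
          firstCols hk (U w) := by
        have : (U w * (1 : Matrix (Fin r) (Fin r) ℂ)).submatrix id (Fin.castLE hk) =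
          U w * (1 : Matrix (Fin r) (Fin r) ℂ).submatrix id (Fin.castLE hk) := rfl
        rw [← this, Matrix.mul_one]
        rfl
      rw [Matrix.mul_assoc, h4, projFilter, Matrix.mul_assoc, firstCols_orthonormal h1,
        Matrix.mul_one]
    calc k = (firstCols hk (U w)).rank := (rank_firstCols h1 hk).symm
      _ ≤ (projFilter hk U w * U w).rank := by
        rw [← h3]
        exact Matrix.rank_mul_le_left _ _

/-- The residual keeps exactly the columns √λ_j u_j with j > k, each of squared norm λ_j; this is
the equality case of `sum_tail_le`. -/
theorem IsSpectralDecomposition.sum_norm_sq_sub_projFilter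
    (h : IsSpectralDecomposition r f lam U) (hk : k ≤ r) :
    ∀ᵐ w ∂freqMeasure, ∑ a, ∑ j,
      ‖(((1 : Matrix (Fin d) (Fin d) ℂ) - projFilter hk U w) * sqrtFactor lam U w) a j‖ ^ 2 =
      ∑ j ∈ Finset.Icc (k + 1) r, lam j w := by
  filter_upwards [h.projFilter_mul hk, h.sum_norm_sq_sqrtFactor] with w h1 h2
  rw [sum_Icc_eq_sum_fin k r fun j => lam j w, Finset.sum_comm, Finset.sum_filter,
    Matrix.sub_mul, h1, Matrix.one_mul]
  refine Finset.sum_congr rfl fun j _ => ?_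
  split_ifs with hj
  · rw [← h2 j]
    refine Finset.sum_congr rfl fun a _ => ?_
    simp [not_lt.2 hj]
  · refine Finset.sum_eq_zero fun a _ => ?_
    simp [not_le.1 hj]

theorem IsSpectralDecomposition.sum_norm_sq (h : IsSpectralDecomposition r f lam U) :
    ∀ᵐ w ∂freqMeasure, ∑ a, ∑ j, ‖((1 : Matrix (Fin d) (Fin d) ℂ) * sqrtFactor lam U w) a j‖ ^ 2 =
      ∑ j ∈ Finset.Icc 1 r, lam j w := by
  filter_upwards [h.sum_norm_sq_sqrtFactor] with w h2
  have := sum_Icc_eq_sum_fin 0 r fun j => lam j w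
  rw [zero_add] at this
  rw [this, Finset.sum_comm, Matrix.one_mul]
  simp [h2]

/-- The pointwise lower bound for filters of rank at most `k`. -/
theorem IsSpectralDecomposition.sum_tail_le (h : IsSpectralDecomposition r f lam U)
    (hk1 : 1 ≤ k) (hk : k ≤ r) {T : ℝ → Matrix (Fin d) (Fin d) ℂ}
    (hT : ∀ᵐ w ∂freqMeasure, (T w * sqrtFactor lam U w).rank ≤ k) :
    ∀ᵐ w ∂freqMeasure, ∑ j ∈ Finset.Icc (k + 1) r, lam j w ≤
      ∑ a, ∑ j, ‖(((1 : Matrix (Fin d) (Fin d) ℂ) - T w) * sqrtFactor lam U w) a j‖ ^ 2 := by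
  filter_upwards [hT, h.pos_fin, h.antitone, h.orthonormal] with w h1 h2 h3 h4
  rw [sum_Icc_eq_sum_fin k r fun j => lam j w, Matrix.sub_mul, Matrix.one_mul]
  refine sum_tail_le_of_rank_le hk1 hk h4 (l := fun j => lam (j.val + 1) w) (fun j => (h2 j).le)
    (fun i j hij => ?_) h1
  have : i.val ≤ j.val := hij
  exact h3 _ _ (by omega) (by omega) (by omega)

end Decomposition

/-! ### Integrals over the frequency interval. -/

theorem freqMeasure_ne_zero : freqMeasure ≠ 0 := by
  rw [Ne, Measure.restrict_eq_zero, Real.volume_Icc]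
  simp [Real.pi_pos]

theorem integral_freq_const (c : ℝ) : ∫ _ in freq, c = 2 * Real.pi * c := by
  rw [setIntegral_const, Real.volume_real_Icc_of_le (by linarith [Real.pi_pos]), smul_eq_mul]
  ring

theorem sum_Icc_split {k r : ℕ} (hkr : k ≤ r) (g : ℕ → ℝ) :
    ∑ j ∈ Finset.Icc 1 r, g j = ∑ j ∈ Finset.Icc 1 k, g j + ∑ j ∈ Finset.Icc (k + 1) r, g j := by
  simp only [← Finset.Ico_add_one_right_eq_Icc]
  exact (Finset.sum_Ico_consecutive g (by omega) (by omega)).symm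

theorem integral_pos_of_decomposition {d r : ℕ} {f : ℝ → Matrix (Fin d) (Fin d) ℂ}
    {lam : ℕ → ℝ → ℝ} {U : ℝ → Matrix (Fin d) (Fin r) ℂ} (hr : 1 ≤ r)
    (hdec : IsSpectralDecomposition r f lam U)
    (hI : IntegrableOn (fun w => ∑ j ∈ Finset.Icc 1 r, lam j w) freq) :
    0 < ∫ w in freq, ∑ j ∈ Finset.Icc 1 r, lam j w := by
  have hpos : ∀ᵐ w ∂freqMeasure, 0 < ∑ j ∈ Finset.Icc 1 r, lam j w := by
    filter_upwards [hdec.pos] with w hw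
    refine Finset.sum_pos (fun j hj => ?_) ⟨1, by simp [hr]⟩
    rw [Finset.mem_Icc] at hj
    exact hw j hj.1 hj.2
  have h0 : 0 ≤ᵐ[freqMeasure] fun w => ∑ j ∈ Finset.Icc 1 r, lam j w :=
    hpos.mono fun w hw => hw.le
  refine lt_of_le_of_ne (integral_nonneg_of_ae h0) fun h => ?_
  have hz := (integral_eq_zero_iff_of_nonneg_ae h0 hI).1 h.symm
  have hne : (ae freqMeasure).NeBot := ae_neBot.2 freqMeasure_ne_zero
  obtain ⟨w, h1, h2⟩ := (hpos.and hz).exists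
  exact h1.ne' h2

end RankReduction

/-! ### The main theorem. -/

open RankReduction

theorem mainTheorem5 {Ω : Type*} [MeasurableSpace Ω] (P : Measure Ω) [IsProbabilityMeasure P]
    (d r k : ℕ) (hr : 1 ≤ r) (hrd : r ≤ d) (hk : 1 ≤ k) (hkr : k ≤ r)
    (X : ℤ → RankReduction.L2Vec P d) (hX : RankReduction.IsStationary X)
    (f : ℝ → Matrix (Fin d) (Fin d) ℂ) (hf : RankReduction.IsSpectralDensity X f)
    (hrank : ∀ᵐ w ∂(volume.restrict RankReduction.freq), (f w).rank = r)
    (lam : ℕ → ℝ → ℝ) (U : ℝ → Matrix (Fin d) (Fin r) ℂ)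
    (hdec : RankReduction.IsSpectralDecomposition r f lam U) :
    -- Cramér's representation of `X` exists, with a unique random measure `Z`
    (∃! Z, RankReduction.IsCramerMeasure X f Z) ∧
    ∀ Z, RankReduction.IsCramerMeasure X f Z →
      -- the filtered process is well defined
      (∃! Xk, RankReduction.IsFiltered f Z (RankReduction.projFilter hkr U) Xk) ∧
      ∀ Xk, RankReduction.IsFiltered f Z (RankReduction.projFilter hkr U) Xk →
        -- (a) it has constant rank `k` and minimizes the mean square error
        (RankReduction.HasConstantRank Xk k ∧
          (∀ᵐ w ∂(volume.restrict RankReduction.freq),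
            (RankReduction.projFilter hkr U w).rank = k) ∧
          ∀ T Y, RankReduction.IsFiltered f Z T Y →
            ((∃ g, RankReduction.IsSpectralDensity Y g ∧
                ∀ᵐ w ∂(volume.restrict RankReduction.freq), (g w).rank ≤ k) ∨
              ∀ᵐ w ∂(volume.restrict RankReduction.freq), (T w).rank ≤ k) →
            ∀ t, ‖X t - Xk t‖ ^ 2 ≤ ‖X t - Y t‖ ^ 2) ∧
        -- (b) the error and the relative error
        (IntegrableOn (fun w => ∑ j ∈ Finset.Icc 1 r, lam j w) RankReduction.freq ∧
          IntegrableOn (fun w => ∑ j ∈ Finset.Icc (k + 1) r, lam j w) RankReduction.freq ∧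
          ∀ t, ‖X t - Xk t‖ ^ 2 =
              ∫ w in RankReduction.freq, ∑ j ∈ Finset.Icc (k + 1) r, lam j w ∧
            0 < ‖X t‖ ∧
            ‖X t - Xk t‖ ^ 2 / ‖X t‖ ^ 2 =
              (∫ w in RankReduction.freq, ∑ j ∈ Finset.Icc (k + 1) r, lam j w) /
                ∫ w in RankReduction.freq, ∑ j ∈ Finset.Icc 1 r, lam j w) ∧
        -- (c) the bounds under an eigenvalue gap
        ∀ Δ ε : ℝ, ε < Δ →
          (∀ᵐ w ∂(volume.restrict RankReduction.freq), Δ ≤ lam k w ∧ lam (k + 1) w ≤ ε) →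
          ∀ t, ‖X t - Xk t‖ ≤ Real.sqrt (2 * Real.pi * ((r : ℝ) - k) * ε) ∧
            ‖X t - Xk t‖ / ‖X t‖ ≤ Real.sqrt (((r : ℝ) - k) * ε / (k * Δ)) := by
  have hM := hdec.isFactor hf.integrable
  refine ⟨hM.existsUnique_cramer hf, fun Z hZ => ?_⟩
  obtain ⟨J, hJ⟩ := hM.exists_induces hZ.cov_eq
  refine ⟨hJ.existsUnique_isFiltered (hdec.aemeasurable_projFilter hkr)
    (hdec.memLp_projFilter_mul hf.integrable hkr), fun Xk hXk => ?_⟩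
  have hI1 := hdec.integrable_lam hf.integrable 0
  rw [zero_add] at hI1
  have hIk := hdec.integrable_lam hf.integrable k
  have hXn : ∀ t, ‖X t‖ ^ 2 = ∫ w in freq, ∑ j ∈ Finset.Icc 1 r, lam j w := fun t =>
    (hJ.norm_sq_filtered hZ.represents t).2.trans (integral_congr_ae hdec.sum_norm_sq)
  have herr : ∀ t, ‖X t - Xk t‖ ^ 2 = ∫ w in freq, ∑ j ∈ Finset.Icc (k + 1) r, lam j w := fun t =>
    (hJ.norm_sq_filtered (hJ.isFiltered_sub hZ.represents hXk) t).2.trans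
      (integral_congr_ae (hdec.sum_norm_sq_sub_projFilter hkr))
  have hpos : 0 < ∫ w in freq, ∑ j ∈ Finset.Icc 1 r, lam j w :=
    integral_pos_of_decomposition hr hdec hI1
  have hXpos : ∀ t, 0 < ‖X t‖ := fun t => by
    have h := hXn t ▸ hpos
    exact lt_of_le_of_ne (norm_nonneg _) fun h0 => by simp [← h0] at h
  have hsplit : ∀ w, ∑ j ∈ Finset.Icc 1 r, lam j w =
      ∑ j ∈ Finset.Icc 1 k, lam j w + ∑ j ∈ Finset.Icc (k + 1) r, lam j w := fun w =>
    sum_Icc_split hkr fun j => lam j w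
  have hden := hJ.isSpectralDensity hXk
  refine ⟨⟨⟨hden.isStationary (hJ.integral_filtered_eq_zero hZ.represents hX.mean_zero hXk), _,
    hden, ?_⟩, ?_, ?_⟩, ⟨hI1, hIk, fun t => ⟨herr t, hXpos t, by rw [herr, hXn]⟩⟩, ?_⟩
  · filter_upwards [hM.rank_filtered_eq (projFilter hkr U), hdec.rank_projFilter_mul hkr]
      with w h1 h2
    rw [h1, h2]
  · filter_upwards [hdec.orthonormal] with w hw
    rw [projFilter, Matrix.rank_self_mul_conjTranspose, rank_firstCols hw]
  · intro T Y hY hrk t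
    -- The density given with the rank bound agrees a.e. with T f T^*, whose rank is that of T M; a
    -- bound on rank T passes to T M directly.
    have hTM : ∀ᵐ w ∂freqMeasure, (T w * sqrtFactor lam U w).rank ≤ k := by
      rcases hrk with ⟨g, hg, hgr⟩ | hT
      · filter_upwards [hg.ae_eq (hJ.isSpectralDensity hY), hgr, hM.rank_filtered_eq T]
          with w h1 h2 h3
        rwa [← h3, ← h1]
      · filter_upwards [hT] with w hw
        exact (Matrix.rank_mul_le_left _ _).trans hw
    obtain ⟨hint, hn⟩ := hJ.norm_sq_filtered (hJ.isFiltered_sub hZ.represents hY) t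
    rw [herr, hn]
    exact integral_mono_ae hIk hint (hdec.sum_tail_le hk hkr hTM)
  · intro Δ ε hΔε hgap t
    -- For k = r the error is zero. This case is separate because the sign of `ε` is deduced from
    -- λ_{k+1} > 0, which requires k < r.
    rcases hkr.eq_or_lt with rfl | hlt
    · have h0 : ‖X t - Xk t‖ = 0 := by
        have h := herr t
        rw [Finset.Icc_eq_empty (by omega)] at h
        simpa using h
      rw [h0]
      simp
    · have hε : 0 < ε := by
        have : (freqMeasure : Measure ℝ) ≠ 0 := freqMeasure_ne_zero
        have hne : (ae freqMeasure).NeBot := ae_neBot.2 this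
        obtain ⟨w, h1, h2⟩ := (hgap.and hdec.pos).exists
        exact (h2 (k + 1) (by omega) (by omega)).trans_le h1.2
      have hΔ : 0 < Δ := hε.trans hΔε
      have hk0 : (0 : ℝ) < k := by exact_mod_cast hk
      have hrk : (0 : ℝ) ≤ (r : ℝ) - k := sub_nonneg.2 (by exact_mod_cast hkr)
      have hub : ‖X t - Xk t‖ ^ 2 ≤ 2 * Real.pi * (((r : ℝ) - k) * ε) := by
        rw [herr, ← integral_freq_const]
        refine integral_mono_ae hIk (integrable_const _) ?_
        filter_upwards [hgap, hdec.antitone] with w h1 h2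
        calc ∑ j ∈ Finset.Icc (k + 1) r, lam j w ≤ ∑ j ∈ Finset.Icc (k + 1) r, ε :=
              Finset.sum_le_sum fun j hj => by
                rw [Finset.mem_Icc] at hj
                exact (h2 (k + 1) j (by omega) hj.1 hj.2).trans h1.2
          _ = ((r : ℝ) - k) * ε := by
              rw [Finset.sum_const, Nat.card_Icc, nsmul_eq_mul, Nat.add_sub_add_right,
                Nat.cast_sub hkr]
      -- Only the first k eigenvalues are kept, each at least λ_k ≥ Δ; the nonnegative tail is
      -- dropped.
      have hlb : 2 * Real.pi * (k * Δ) ≤ ‖X t‖ ^ 2 := by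
        rw [hXn, ← integral_freq_const]
        refine integral_mono_ae (integrable_const _) hI1 ?_
        filter_upwards [hgap, hdec.antitone, hdec.pos] with w h1 h2 h3
        simp only [hsplit]
        calc (k : ℝ) * Δ = ∑ j ∈ Finset.Icc 1 k, Δ := by simp
          _ ≤ ∑ j ∈ Finset.Icc 1 k, lam j w := Finset.sum_le_sum fun j hj => by
                rw [Finset.mem_Icc] at hj
                exact h1.1.trans (h2 j k hj.1 hj.2 hkr)
          _ ≤ _ := le_add_of_nonneg_right (Finset.sum_nonneg fun j hj => by
                rw [Finset.mem_Icc] at hj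
                exact (h3 j (by omega) hj.2).le)
      constructor
      · refine Real.le_sqrt_of_sq_le (hub.trans_eq (by ring))
      · refine Real.le_sqrt_of_sq_le ?_
        rw [div_pow]
        calc ‖X t - Xk t‖ ^ 2 / ‖X t‖ ^ 2
            ≤ (2 * Real.pi * (((r : ℝ) - k) * ε)) / (2 * Real.pi * (k * Δ)) :=
              div_le_div₀ (by positivity) hub (by positivity) hlb
          _ = ((r : ℝ) - k) * ε / (k * Δ) := mul_div_mul_left _ _ (by positivity)
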